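/- Let $X$ be a compact metric space with Borel $\sigma$-algebra $\mathcal B_X$, let $T=(T^{(m,n)})_{(m,n)\in\mathbb Z^2}$ be an action of $\mathbb Z^2$ on $X$ by homeomorphisms, and let $\mu$ be a $T$-invariant Borel probability measure on $X$. Write $U_T^{(m,n)}f=f\circ T^{(m,n)}$ for $f$ in the complex Hilbert space $L^2(X,\mathcal B_X,\mu)$. Let $\beta\in\mathbb R$ and $\vec v=(1,\beta)$; for $b>0$ and $k\in\mathbb N$ put $$\Lambda^{\vec v}(b)=\{(m,n)\in\mathbb Z^2:\beta m-b/2\le n\le\beta m+b/2\},\qquad \Lambda^{\vec v}_k(b)=\Lambda^{\vec v}(b)\cap([0,k-1]\times\mathbb Z).$$ For $c>0$ let $\mathcal K^{\vec v}_\mu(c)$ be the collection of all $B\in\mathcal B_X$ such that the closure of $\{U_T^{(m,n)}1_B:(m,n)\in\Lambda^{\vec v}(c)\}$ is compact in $L^2(X,\mathcal B_X,\mu)$. The system $(X,\mathcal B_X,\mu,T)$ is called $\vec v$-weak mixing if every $B\in\mathcal K^{\vec v}_\mu(c)$ has $\mu(B)=0$ or $\mu(B)=1$. **Theorem.** Let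 $b,c\in(0,\infty)$. The following are equivalent. (a) $(X,\mathcal B_X,\mu,T)$ is $\vec v$-weak mixing (with respect to $\mathcal K^{\vec v}_\mu(c)$; since $b$ and $c$ are arbitrary, the notion does not depend on $c$). (b) For every infinite subset $Q$ of $\Lambda^{\vec v}(b)$ with $$\liminf_{k\to\infty}\frac{\#(Q\cap([0,k-1]\times\mathbb Z))}{\#\Lambda^{\vec v}_k(b)}>0,$$ and every enumeration $Q=\{(m_i,n_i)\}_{i=1}^\infty$ without repetition such that $|m_1|\le|m_2|\le\cdots$ (that is, $m_1\le m_2\le\cdots$ if $Q\subset\mathbb Z_{\ge0}\times\mathbb Z$), one has $$\lim_{N\to\infty}\Big\|\frac1N\sum_{i=1}^N U_T^{(m_i,n_i)}f-\int_X f\,d\mu\Big\|_2=0\qquad\text{for all } f\in L^2(X,\mathcal B_X,\mu).$$ -/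

import Mathlib

open MeasureTheory Filter Topology

noncomputable section

namespace DirectionalWeakMixing

/-- The strip of width `b` around the line of direction `(1, β)`:
the lattice points `(m, n)` with `β m - b / 2 ≤ n ≤ β m + b / 2`. -/
def strip (β b : ℝ) : Set (ℤ × ℤ) :=
  {p | β * (p.1 : ℝ) - b / 2 ≤ (p.2 : ℝ) ∧ (p.2 : ℝ) ≤ β * (p.1 : ℝ) + b / 2}

/-- The slab `[0, k - 1] × ℤ`. -/
def slab (k : ℕ) : Set (ℤ × ℤ) := {p | 0 ≤ p.1 ∧ p.1 ≤ (k : ℤ) - 1}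

/-- The lower density of `Q` relative to the strip: the lower limit of
`#(Q ∩ ([0, k - 1] × ℤ)) / #(strip ∩ ([0, k - 1] × ℤ))`. -/
def lowerRelDensity (β b : ℝ) (Q : Set (ℤ × ℤ)) : ℝ :=
  liminf (fun k : ℕ => ((Q ∩ slab k).ncard : ℝ) / ((strip β b ∩ slab k).ncard : ℝ)) atTop

section System

variable {X : Type*} [MeasurableSpace X] [AddAction (ℤ × ℤ) X] [MeasurableConstVAdd (ℤ × ℤ) X]
  (μ : Measure X) [VAddInvariantMeasure (ℤ × ℤ) X μ]

/-- The Koopman operator `f ↦ f ∘ T^g` on complex `L²`, where `T^g x = g +ᵥ x`. -/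
def koopman (g : ℤ × ℤ) (f : Lp ℂ 2 μ) : Lp ℂ 2 μ :=
  Lp.compMeasurePreserving (fun x : X => g +ᵥ x) (measurePreserving_vadd g μ) f

/-- The directional Kronecker algebra, formed with the strip of width `c`: the measurable sets `B`
for which the orbit of the indicator function of `B` along the strip has compact closure in `L²`. -/
def kroneckerAlgebra [IsFiniteMeasure μ] (β c : ℝ) : Set (Set X) :=
  {B | ∃ hB : MeasurableSet B,
    IsCompact (closure ((fun g : ℤ × ℤ =>
      koopman μ g (indicatorConstLp 2 hB (measure_ne_top μ B) (1 : ℂ))) '' strip β c))}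

/-- Weak mixing in direction `(1, β)`: the directional Kronecker algebra is trivial modulo
null sets. -/
def IsWeakMixing [IsFiniteMeasure μ] (β c : ℝ) : Prop :=
  ∀ B ∈ kroneckerAlgebra μ β c, B =ᵐ[μ] (∅ : Set X) ∨ B =ᵐ[μ] (Set.univ : Set X)

end System

/-- `q 0, q 1, q 2, …` lists every element of `Q` exactly once, in order of nondecreasing
absolute value of the first coordinate. -/
structure IsOrderedEnumeration (Q : Set (ℤ × ℤ)) (q : ℕ → ℤ × ℤ) : Prop where
  injective : Function.Injective q
  range_eq : Set.range q = Q
  monotone_abs : Monotone fun i => |(q i).1|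

end DirectionalWeakMixing

end

/-! Weak mixing implies convergence. Subtract the mean from f and write u_g = U^g f. The tent
operators x ↦ ∑ w_N(g) ⟨u_g, x⟩ u_g, with weights spread over a strip of length of order N, have
uniformly bounded norm and trace. A weak operator limit K along an ultrafilter is positive with
finite trace, hence compact (`totallyBounded_image_closedBall_of_trace_le`). The weights are
Lipschitz, so K commutes with U^d up to an error proportional to the height of d. Since finitely
many heights approximate all heights in a strip, every vector K x has a totally bounded orbit along
the strip (`totallyBounded_orbit_of_tendsto`).

In a weakly mixing system such vectors are constant: superlevel sets of their real and imaginary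
parts, at levels without mass, lie in the Kronecker algebra (`exists_eq_const_of_totallyBounded`).
Hence ⟨K f, f⟩ = 0, which says that |⟨U^g f, f⟩|² tends to zero on average over the strip. Positive
lower density makes the enumeration grow at most linearly, so the differences q_i - q_j with i, j <
N fill a fixed proportion of a box of length O(N), and Cauchy–Schwarz bounds the fourth power of the
averaged norm by that mean (`tendsto_norm_average_orbit`).

Conversely, let u be the indicator of a set in the Kronecker algebra. Its ε-return times along the
strip are relatively dense, hence of positive lower density
(`exists_enumeration_of_totallyBounded`). Averages of u over them stay within ε of u and converge to
the mean of u, so u is constant. -/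

namespace DirectionalWeakMixing

/-! ### Lattice points in strips: height nets and counting -/

/-- The signed vertical distance of a lattice point from the line of slope `β`. -/
def height (β : ℝ) : ℤ × ℤ →+ ℝ where
  toFun g := (g.2 : ℝ) - β * g.1
  map_zero' := by simp
  map_add' g h := by push_cast [Prod.fst_add, Prod.snd_add]; ring

theorem height_apply (β : ℝ) (g : ℤ × ℤ) : height β g = (g.2 : ℝ) - β * g.1 := rfl

theorem mem_strip_iff {β b : ℝ} {g : ℤ × ℤ} : g ∈ strip β b ↔ |height β g| ≤ b / 2 := by
  rw [strip, Set.mem_ofPred_eq, height_apply, abs_le]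
  constructor <;> rintro ⟨h1, h2⟩ <;> constructor <;> linarith

theorem strip_mono (β : ℝ) {b c : ℝ} (h : b ≤ c) : strip β b ⊆ strip β c := fun g hg => by
  rw [mem_strip_iff] at *; linarith

theorem sub_mem_strip {β b c : ℝ} {g h : ℤ × ℤ} (hg : g ∈ strip β b) (hh : h ∈ strip β c) :
    g - h ∈ strip β (b + c) := by
  rw [mem_strip_iff] at *
  rw [map_sub]
  linarith [abs_sub (height β g) (height β h)]

/-- The heights occurring in a strip have finite nets. -/
theorem exists_finset_height_net (β c : ℝ) {δ : ℝ} (hδ : 0 < δ) :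
    ∃ F : Finset (ℤ × ℤ), (∀ h ∈ F, h ∈ strip β c) ∧
      ∀ g ∈ strip β c, ∃ h ∈ F, |height β (g - h)| < δ := by
  have htb : TotallyBounded (height β '' strip β c) := by
    refine (totallyBounded_Icc (-(c / 2)) (c / 2)).subset ?_
    rintro _ ⟨g, hg, rfl⟩
    exact abs_le.1 (mem_strip_iff.1 hg)
  obtain ⟨t, hts, htf, htc⟩ := Metric.finite_approx_of_totallyBounded htb δ hδ
  obtain ⟨F, hF, hFt⟩ := Set.exists_subset_bijOn (strip β c ∩ height β ⁻¹' t) (height β)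
  have himg : height β '' (strip β c ∩ height β ⁻¹' t) = t := by
    ext y
    constructor
    · rintro ⟨g, hg, rfl⟩; exact hg.2
    · intro hy
      obtain ⟨g, hg, rfl⟩ := hts hy
      exact ⟨g, ⟨hg, hy⟩, rfl⟩
  rw [himg] at hFt
  have hFfin : F.Finite := Set.Finite.of_finite_image (hFt.image_eq ▸ htf) hFt.injOn
  refine ⟨hFfin.toFinset, fun h hh => (hF (hFfin.mem_toFinset.1 hh)).1, fun g hg => ?_⟩
  obtain ⟨y, hy, hgy⟩ := Set.mem_iUnion₂.1 (htc (Set.mem_image_of_mem _ hg))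
  obtain ⟨h, hh, rfl⟩ := hFt.surjOn hy
  refine ⟨h, hFfin.mem_toFinset.2 hh, ?_⟩
  rw [map_sub]
  exact hgy

/-- The lattice points at height at most `R` whose first coordinate is at most `N` in
absolute value. -/
noncomputable def box (β R : ℝ) (N : ℕ) : Finset (ℤ × ℤ) :=
  (Finset.Icc (-(N : ℤ)) N).biUnion fun m =>
    (Finset.Icc ⌈β * m - R⌉ ⌊β * m + R⌋).image fun n => (m, n)

theorem mem_box {β R : ℝ} {N : ℕ} {g : ℤ × ℤ} :
    g ∈ box β R N ↔ |g.1| ≤ N ∧ |height β g| ≤ R := by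
  rcases g with ⟨m, n⟩
  simp only [box, Finset.mem_biUnion, Finset.mem_image, Finset.mem_Icc, Prod.mk.injEq, abs_le,
    height_apply]
  constructor
  · rintro ⟨m', hm, n', ⟨h1, h2⟩, rfl, rfl⟩
    rw [Int.ceil_le] at h1
    rw [Int.le_floor] at h2
    exact ⟨hm, by linarith, by linarith⟩
  · rintro ⟨hm, h1, h2⟩
    refine ⟨m, hm, n, ⟨?_, ?_⟩, rfl, rfl⟩
    · rw [Int.ceil_le]; linarith
    · rw [Int.le_floor]; linarith

theorem card_box_le (β : ℝ) {R : ℝ} (hR : 0 ≤ R) (N : ℕ) :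
    ((box β R N).card : ℝ) ≤ (2 * N + 1) * (2 * R + 1) := by
  have hcol : ∀ m : ℤ, (((Finset.Icc ⌈β * m - R⌉ ⌊β * m + R⌋).image fun n => (m, n)).card : ℝ)
      ≤ 2 * R + 1 := by
    intro m
    refine (Nat.cast_le.2 Finset.card_image_le).trans ?_
    rw [Int.card_Icc]
    rcases le_total (⌊β * m + R⌋ + 1 - ⌈β * m - R⌉) 0 with h | h
    · rw [Int.toNat_of_nonpos h]; simp; linarith
    · have : ((⌊β * m + R⌋ + 1 - ⌈β * m - R⌉).toNat : ℝ)
          = ((⌊β * m + R⌋ + 1 - ⌈β * m - R⌉ : ℤ) : ℝ) := by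
        exact_mod_cast Int.toNat_of_nonneg h
      rw [this]
      push_cast
      linarith [Int.floor_le (β * m + R), Int.le_ceil (β * m - R)]
  calc ((box β R N).card : ℝ)
      ≤ ∑ m ∈ Finset.Icc (-(N : ℤ)) N,
          (((Finset.Icc ⌈β * m - R⌉ ⌊β * m + R⌋).image fun n => (m, n)).card : ℝ) := by
        exact_mod_cast Finset.card_biUnion_le
    _ ≤ ∑ m ∈ Finset.Icc (-(N : ℤ)) N, (2 * R + 1) := Finset.sum_le_sum fun m _ => hcol m
    _ = (2 * N + 1) * (2 * R + 1) := by
        rw [Finset.sum_const, Int.card_Icc, nsmul_eq_mul]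
        congr 1
        have : ((N : ℤ) + 1 - -(N : ℤ)).toNat = 2 * N + 1 := by omega
        rw [this]; push_cast; ring

theorem strip_inter_slab_subset_box (β b : ℝ) (k : ℕ) :
    strip β b ∩ slab k ⊆ box β (b / 2) k := by
  rintro g ⟨hg, h0, h1⟩
  exact mem_box.2 ⟨abs_le.2 ⟨by omega, by omega⟩, mem_strip_iff.1 hg⟩

theorem finite_strip_inter_slab (β b : ℝ) (k : ℕ) : (strip β b ∩ slab k).Finite :=
  (box β (b / 2) k).finite_toSet.subset (strip_inter_slab_subset_box β b k)

theorem ncard_strip_inter_slab_le (β : ℝ) {b : ℝ} (hb : 0 ≤ b) (k : ℕ) :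
    ((strip β b ∩ slab k).ncard : ℝ) ≤ (2 * k + 1) * (b + 1) := by
  have h1 : (strip β b ∩ slab k).ncard ≤ (box β (b / 2) k).card := by
    rw [← Set.ncard_coe_finset]
    exact Set.ncard_le_ncard (strip_inter_slab_subset_box β b k) (Finset.finite_toSet _)
  have h2 := card_box_le β (by linarith : 0 ≤ b / 2) k
  have h3 : ((strip β b ∩ slab k).ncard : ℝ) ≤ (box β (b / 2) k).card := by exact_mod_cast h1
  linarith

theorem round_mem_strip (β : ℝ) (m : ℤ) : (m, round (β * m)) ∈ strip β 1 := by
  rw [mem_strip_iff, height_apply, abs_sub_comm]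
  exact abs_sub_round _

/-- A set whose finitely many translates cover the strip of width one meets the slabs in a
linearly growing number of points. -/
theorem exists_linear_le_ncard {β : ℝ} {Q : Set (ℤ × ℤ)} (hQ : ∀ k, (Q ∩ slab k).Finite)
    (F : Finset (ℤ × ℤ)) (hF : ∀ g ∈ strip β 1, 0 ≤ g.1 → ∃ p ∈ F, 0 ≤ (g - p).1 → g - p ∈ Q) :
    ∃ δ : ℝ, 0 < δ ∧ ∀ᶠ k : ℕ in atTop, δ * k ≤ ((Q ∩ slab k).ncard : ℝ) := by
  obtain ⟨M, hM⟩ : ∃ M : ℕ, ∀ p ∈ F, |p.1| ≤ M := by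
    refine ⟨F.sup fun p => p.1.natAbs, fun p hp => ?_⟩
    have : p.1.natAbs ≤ F.sup fun p => p.1.natAbs := Finset.le_sup (f := fun p => p.1.natAbs) hp
    rw [Int.abs_eq_natAbs]
    exact_mod_cast this
  choose! p hpF hpQ using fun m : ℤ => fun hm : 0 ≤ m => hF _ (round_mem_strip β m) hm
  refine ⟨1 / (2 * (F.card + 1)), by positivity, ?_⟩
  -- Columns within `M` of either end are dropped, so that subtracting an element of `F` stays
  -- inside the slab; at least half of the columns remain.
  filter_upwards [eventually_ge_atTop (4 * M)] with k hk
  -- Sending a column to the chosen translation and the translated point is injective, since their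
  -- sum recovers the column.
  have hcard : (Finset.Ico (M : ℤ) (k - M)).card ≤ (F ×ˢ (hQ k).toFinset).card := by
    refine Finset.card_le_card_of_injOn (fun m => (p m, (m, round (β * m)) - p m)) ?_ ?_
    · intro m hm
      rw [Finset.mem_coe, Finset.mem_Ico] at hm
      have hm0 : 0 ≤ m := by omega
      have h1 := abs_le.1 (hM _ (hpF m hm0))
      have h2 : 0 ≤ ((m, round (β * m)) - p m).1 := by
        rw [Prod.fst_sub]; dsimp only; omega
      rw [Finset.mem_coe, Finset.mem_product, Set.Finite.mem_toFinset]
      refine ⟨hpF m hm0, hpQ m hm0 h2, h2, ?_⟩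
      rw [Prod.fst_sub]; dsimp only; omega
    · intro m _ m' _ h
      rw [Prod.mk.injEq] at h
      obtain ⟨h1, h2⟩ := h
      rw [h1] at h2
      exact congrArg Prod.fst (sub_left_injective h2)
  rw [Finset.card_product, Int.card_Ico, ← Set.ncard_eq_toFinset_card _ (hQ k)] at hcard
  have h3 : k ≤ 2 * (F.card * (Q ∩ slab k).ncard) := by omega
  have h4 : (k : ℝ) ≤ 2 * (F.card * (Q ∩ slab k).ncard) := by exact_mod_cast h3
  rw [div_mul_eq_mul_div, one_mul, div_le_iff₀ (by positivity)]
  nlinarith [Nat.cast_nonneg (α := ℝ) (Q ∩ slab k).ncard]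

/-- Finitely many translates of a strip of any positive width cover the strip of width one, because
a bounded interval of heights has a finite net. -/
theorem exists_linear_le_ncard_strip (β : ℝ) {b : ℝ} (hb : 0 < b) :
    ∃ δ : ℝ, 0 < δ ∧ ∀ᶠ k : ℕ in atTop, δ * k ≤ ((strip β b ∩ slab k).ncard : ℝ) := by
  obtain ⟨F, -, hF⟩ := exists_finset_height_net β 1 (half_pos hb)
  refine exists_linear_le_ncard (β := β) (finite_strip_inter_slab β b) F fun g hg _ => ?_
  obtain ⟨p, hp, h⟩ := hF g hg
  exact ⟨p, hp, fun _ => mem_strip_iff.2 h.le⟩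

/-! ### Weak operator limits and compactness from finite trace -/

section WeakLimits

variable {H : Type*} [NormedAddCommGroup H] [InnerProductSpace ℂ H]

/-- Bounded sequences of operators converge along ultrafilters in the weak operator topology. -/
theorem exists_tendsto_inner_of_norm_le [CompleteSpace H] (T : ℕ → H →L[ℂ] H) {C : ℝ}
    (hT : ∀ n, ‖T n‖ ≤ C) (𝒰 : Ultrafilter ℕ) :
    ∃ K : H →L[ℂ] H, ∀ x y : H,
      Tendsto (fun n => inner ℂ (T n x) y) 𝒰 (𝓝 (inner ℂ (K x) y)) := by
  have hbound : ∀ (x y : H) (n : ℕ), ‖inner ℂ (T n x) y‖ ≤ C * ‖x‖ * ‖y‖ := fun x y n =>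
    (norm_inner_le_norm _ _).trans
      (mul_le_mul_of_nonneg_right ((T n).le_of_opNorm_le (hT n) x) (norm_nonneg y))
  -- An ultrafilter gives all these limits at once, so no separability or diagonal argument is
  -- needed.
  have hex : ∀ x y, ∃ l : ℂ, Tendsto (fun n => inner ℂ (T n x) y) 𝒰 (𝓝 l) := by
    intro x y
    obtain ⟨l, -, hl⟩ := (isCompact_closedBall (0 : ℂ) (C * ‖x‖ * ‖y‖)).ultrafilter_le_nhds
      (𝒰.map fun n => inner ℂ (T n x) y) (by
        rw [le_principal_iff]
        exact Filter.mem_map.2 (univ_mem' fun n => mem_closedBall_zero_iff.2 (hbound x y n)))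
    exact ⟨l, hl⟩
  choose B hB using hex
  have hB' : ∀ x y l, Tendsto (fun n => inner ℂ (T n x) y) 𝒰 (𝓝 l) → B x y = l :=
    fun x y l h => tendsto_nhds_unique (hB x y) h
  let L : H →ₗ⋆[ℂ] H →ₗ[ℂ] ℂ := LinearMap.mk₂'ₛₗ (starRingEnd ℂ) (RingHom.id ℂ) B
    (fun x x' y => hB' _ _ _ (by
      simpa only [map_add, inner_add_left] using (hB x y).add (hB x' y)))
    (fun a x y => hB' _ _ _ (by
      simpa only [map_smul, inner_smul_left, smul_eq_mul] using
        (hB x y).const_mul ((starRingEnd ℂ) a)))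
    (fun x y y' => hB' _ _ _ (by
      simpa only [inner_add_right] using (hB x y).add (hB x y')))
    (fun a x y => hB' _ _ _ (by
      simpa only [inner_smul_right, smul_eq_mul, RingHom.id_apply] using (hB x y).const_mul a))
  let L' : H →L⋆[ℂ] H →L[ℂ] ℂ := L.mkContinuous₂ C fun x y =>
    le_of_tendsto (hB x y).norm (Eventually.of_forall (hbound x y))
  refine ⟨InnerProductSpace.continuousLinearMapOfBilin (𝕜 := ℂ) L', fun x y => ?_⟩
  rw [InnerProductSpace.continuousLinearMapOfBilin_apply]
  exact hB x y

/-- The norm is lower semicontinuous for weak limits. -/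
theorem norm_le_of_tendsto_inner {𝓕 : Filter ℕ} [𝓕.NeBot] {z : ℕ → H} {w : H} {M : ℕ → ℝ} {M₀ : ℝ}
    (hz : Tendsto (fun n => inner ℂ (z n) w) 𝓕 (𝓝 (inner ℂ w w)))
    (hM : Tendsto M 𝓕 (𝓝 M₀)) (h : ∀ᶠ n in 𝓕, ‖z n‖ ≤ M n) : ‖w‖ ≤ M₀ := by
  rcases eq_or_ne w 0 with rfl | hw
  · rw [norm_zero]
    exact ge_of_tendsto hM (h.mono fun n hn => (norm_nonneg _).trans hn)
  · have h1 : ‖inner ℂ w w‖ ≤ M₀ * ‖w‖ :=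
      le_of_tendsto_of_tendsto hz.norm (hM.mul_const ‖w‖)
        (h.mono fun n hn => (norm_inner_le_norm _ _).trans
          (mul_le_mul_of_nonneg_right hn (norm_nonneg w)))
    have h2 : ‖inner ℂ w w‖ = ‖w‖ * ‖w‖ := by
      rw [inner_self_eq_norm_mul_norm (𝕜 := ℂ) w |>.symm, ← inner_self_re_eq_norm]
    rw [h2] at h1
    exact le_of_mul_le_mul_right h1 (norm_pos_iff.2 hw)

/-- A positive operator with finite trace maps balls to totally bounded sets. -/
theorem totallyBounded_image_closedBall_of_trace_le (K : H →L[ℂ] H) {C D : ℝ}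
    (hC : 0 < C) (hK : ∀ x, ‖K x‖ ^ 2 ≤ C * (inner ℂ (K x) x).re)
    (htr : ∀ s : Finset H, Orthonormal ℂ ((↑) : s → H) → ∑ v ∈ s, (inner ℂ (K v) v).re ≤ D)
    {r : ℝ} (hr : 0 < r) :
    TotallyBounded (K '' Metric.closedBall 0 r) := by
  classical
  rw [Metric.totallyBounded_iff]
  intro ε hε
  -- Chosen so that C η r² is half of (ε/2)², which leaves room for a strict inequality.
  set η : ℝ := (ε / 2 / r) ^ 2 / C / 2 with hη
  have hηpos : 0 < η := by positivity
  set S : Set ℝ := {t | ∃ s : Finset H, Orthonormal ℂ ((↑) : s → H) ∧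
    ∑ v ∈ s, (inner ℂ (K v) v).re = t} with hS
  have hSne : S.Nonempty := ⟨_, ∅, by
    refine ⟨fun i => ?_, fun i => ?_⟩ <;> exact absurd i.2 (Finset.notMem_empty _), rfl⟩
  have hSbdd : BddAbove S := ⟨D, by rintro _ ⟨s, hs, rfl⟩; exact htr s hs⟩
  obtain ⟨_, ⟨s, hs, rfl⟩, hlt⟩ := exists_lt_of_lt_csSup hSne (sub_lt_self (sSup S) hηpos)
  set V : Submodule ℂ H := Submodule.span ℂ (s : Set H) with hV
  have : FiniteDimensional ℂ V := FiniteDimensional.span_finset ℂ s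
  -- The partial trace over `s` is within `η` of the supremum, so adjoining one more unit vector
  -- orthogonal to `s` cannot raise it by more than `η`.
  have hunit : ∀ e ∈ Vᗮ, ‖e‖ = 1 → (inner ℂ (K e) e).re ≤ η := by
    intro e he hne
    have hes : e ∉ s := by
      intro hes
      have := (Submodule.mem_orthogonal _ _).1 he e (Submodule.subset_span hes)
      rw [inner_self_eq_zero] at this
      rw [this, norm_zero] at hne
      exact zero_ne_one hne
    have horth : Orthonormal ℂ (fun v : ↥(insert e s) => (v : H)) := by
      refine ⟨?_, ?_⟩
      · rintro ⟨v, hv⟩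
        rcases Finset.mem_insert.1 hv with rfl | hv
        · exact hne
        · exact hs.1 ⟨v, hv⟩
      · rintro ⟨v, hv⟩ ⟨w, hw⟩ hvw
        have hvw' : v ≠ w := fun h => hvw (Subtype.ext h)
        rcases Finset.mem_insert.1 hv with rfl | hv'
        · rcases Finset.mem_insert.1 hw with rfl | hw'
          · exact absurd rfl hvw'
          · exact (Submodule.mem_orthogonal' _ _).1 he w (Submodule.subset_span hw')
        · rcases Finset.mem_insert.1 hw with rfl | hw'
          · exact (Submodule.mem_orthogonal _ _).1 he v (Submodule.subset_span hv')
          · exact hs.2 (i := ⟨v, hv'⟩) (j := ⟨w, hw'⟩) (fun h => hvw' (congrArg Subtype.val h))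
    have := le_csSup hSbdd ⟨_, horth, rfl⟩
    rw [Finset.sum_insert hes] at this
    linarith
  have hperp : ∀ x ∈ Vᗮ, ‖K x‖ ^ 2 ≤ C * η * ‖x‖ ^ 2 := by
    intro x hx
    rcases eq_or_ne x 0 with rfl | hx0
    · simp
    · have hn : ‖x‖ ≠ 0 := norm_ne_zero_iff.2 hx0
      set e : H := ((‖x‖⁻¹ : ℝ) : ℂ) • x with he
      have hne : ‖e‖ = 1 := by
        rw [he, norm_smul, Complex.norm_real, norm_inv, norm_norm, inv_mul_cancel₀ hn]
      have hxe : x = ((‖x‖ : ℝ) : ℂ) • e := by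
        rw [he, smul_smul, ← Complex.ofReal_mul, mul_inv_cancel₀ hn, Complex.ofReal_one, one_smul]
      have h1 := hunit e (Submodule.smul_mem _ _ hx) hne
      have h2 := hK e
      have h3 : ‖K x‖ = ‖x‖ * ‖K e‖ := by
        conv_lhs => rw [hxe, map_smul, norm_smul, Complex.norm_real, norm_norm]
      rw [h3, mul_pow]
      have h4 : ‖K e‖ ^ 2 ≤ C * η := h2.trans (mul_le_mul_of_nonneg_left h1 hC.le)
      nlinarith [sq_nonneg ‖x‖]
  -- On the finite-dimensional part the ball is compact; on the orthogonal complement `K` is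
  -- uniformly small on the ball.
  have hfin : TotallyBounded (K '' ((↑) '' (Metric.closedBall (0 : V) r) : Set H)) :=
    (((isCompact_closedBall (0 : V) r).image continuous_subtype_val).image
      K.continuous).totallyBounded
  obtain ⟨t, htf, ht⟩ := Metric.totallyBounded_iff.1 hfin (ε / 2) (half_pos hε)
  refine ⟨t, htf, ?_⟩
  rintro _ ⟨x, hx, rfl⟩
  rw [mem_closedBall_zero_iff] at hx
  set p : V := V.orthogonalProjectionOnto x with hp
  have hpn : ‖p‖ ≤ r := (V.norm_orthogonalProjectionOnto_apply_le x).trans hx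
  have hpx : x - p ∈ Vᗮ := V.sub_starProjection_mem_orthogonal x
  have hxp : ‖x - p‖ ≤ r := by
    refine le_trans ?_ hx
    have h0 : inner ℂ (x - (p : H)) (p : H) = 0 := (Submodule.mem_orthogonal' _ _).1 hpx p p.2
    have h1 := norm_add_sq_eq_norm_sq_add_norm_sq_of_inner_eq_zero _ _ h0
    rw [sub_add_cancel] at h1
    nlinarith [norm_nonneg x, norm_nonneg (x - (p : H)), norm_nonneg (p : H)]
  obtain ⟨y, hy, hyp⟩ := Set.mem_iUnion₂.1
    (ht ⟨(p : H), ⟨p, mem_closedBall_zero_iff.2 hpn, rfl⟩, rfl⟩)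
  refine Set.mem_iUnion₂.2 ⟨y, hy, ?_⟩
  have h5 : ‖K (x - p)‖ < ε / 2 := by
    have h6 := hperp _ hpx
    have h7 : C * η * ‖x - (p : H)‖ ^ 2 ≤ C * η * r ^ 2 := by gcongr
    have h8 : C * η * r ^ 2 = (ε / 2) ^ 2 / 2 := by rw [hη]; field_simp
    refine lt_of_pow_lt_pow_left₀ 2 (by positivity) ?_
    have : 0 < (ε / 2) ^ 2 := by positivity
    linarith
  rw [Metric.mem_ball] at hyp ⊢
  calc dist (K x) y ≤ dist (K x) (K p) + dist (K p) y := dist_triangle _ _ _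
    _ < ε / 2 + ε / 2 := add_lt_add (by rwa [dist_eq_norm, ← map_sub]) hyp
    _ = ε := add_halves ε

end WeakLimits

/-! ### Tent weights on the strip -/

/-- A tent-shaped averaging weight of total mass `O(1)`, supported in `box β R (2 * N)`. -/
noncomputable def tentWeight (β R : ℝ) (N : ℕ) (g : ℤ × ℤ) : ℝ :=
  1 / N * (max 0 (1 - |(g.1 : ℝ)| / (2 * N)) * max 0 (R - |height β g|))

theorem tentWeight_nonneg (β R : ℝ) (N : ℕ) (g : ℤ × ℤ) : 0 ≤ tentWeight β R N g := by
  unfold tentWeight; positivity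

theorem tentWeight_eq_zero {β R : ℝ} {N : ℕ} {g : ℤ × ℤ} (hg : g ∉ box β R (2 * N)) :
    tentWeight β R N g = 0 := by
  -- For `N = 0` the weight vanishes identically because `1 / 0 = 0`.
  rcases Nat.eq_zero_or_pos N with rfl | hN
  · simp [tentWeight]
  have hN' : (0 : ℝ) < N := by exact_mod_cast hN
  rw [mem_box, not_and_or, not_le, not_le] at hg
  rcases hg with hg | hg
  · have h1 : (2 * N : ℝ) < |(g.1 : ℝ)| := by exact_mod_cast hg
    have h2 : 1 - |(g.1 : ℝ)| / (2 * N) ≤ 0 := by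
      rw [sub_nonpos, one_le_div (by positivity)]; exact h1.le
    rw [tentWeight, max_eq_left h2, zero_mul, mul_zero]
  · rw [tentWeight, max_eq_left (by linarith : R - |height β g| ≤ 0), mul_zero, mul_zero]

theorem tentWeight_le {β R : ℝ} (hR : 0 ≤ R) (N : ℕ) (g : ℤ × ℤ) :
    tentWeight β R N g ≤ 1 / N * R := by
  have h1 : max 0 (1 - |(g.1 : ℝ)| / (2 * N)) ≤ 1 :=
    max_le zero_le_one (sub_le_self _ (by positivity))
  have h2 : max 0 (R - |height β g|) ≤ R := max_le hR (sub_le_self _ (abs_nonneg _))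
  refine mul_le_mul_of_nonneg_left ?_ (by positivity)
  calc _ ≤ 1 * R := mul_le_mul h1 h2 (le_max_left _ _) zero_le_one
    _ = R := one_mul R

/-- The supports are twice as long and one unit higher than the box, so that on it the horizontal
factor is at least 1/2 and the vertical factor at least 1. -/
theorem le_tentWeight {β b : ℝ} {N : ℕ} {g : ℤ × ℤ} (hN : 0 < N) (hg : g ∈ box β b N) :
    1 / (2 * N : ℝ) ≤ tentWeight β (b + 1) N g := by
  have hN' : (0 : ℝ) < N := by exact_mod_cast hN
  rw [mem_box] at hg
  have h0 : |(g.1 : ℝ)| ≤ N := by exact_mod_cast hg.1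
  have h1 : 1 / 2 ≤ max 0 (1 - |(g.1 : ℝ)| / (2 * N)) := by
    refine le_max_of_le_right ?_
    have : |(g.1 : ℝ)| / (2 * N) ≤ 1 / 2 := by
      rw [div_le_div_iff₀ (by positivity) (by positivity)]; linarith
    linarith
  have h2 : 1 ≤ max 0 (b + 1 - |height β g|) := le_max_of_le_right (by linarith [hg.2])
  calc 1 / (2 * N : ℝ) = 1 / N * (1 / 2 * 1) := by field_simp
    _ ≤ _ := mul_le_mul_of_nonneg_left (mul_le_mul h1 h2 zero_le_one (le_max_left _ _))
      (by positivity)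

/-- Both factors are Lipschitz. The horizontal slope 1/(2N) disappears in the limit; the vertical
slope stays 1, so the surviving defect is proportional to the height of `d`. -/
theorem abs_tentWeight_sub_le {β R : ℝ} (hR : 0 ≤ R) (N : ℕ) (g d : ℤ × ℤ) :
    |tentWeight β R N (g - d) - tentWeight β R N g|
      ≤ 1 / N * (|(d.1 : ℝ)| / (2 * N) * R + |height β d|) := by
  rw [tentWeight, tentWeight, ← mul_sub, abs_mul, abs_of_nonneg (by positivity : (0 : ℝ) ≤ 1 / N)]
  refine mul_le_mul_of_nonneg_left ?_ (by positivity)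
  have hp : |max 0 (1 - |((g - d).1 : ℝ)| / (2 * N)) - max 0 (1 - |(g.1 : ℝ)| / (2 * N))|
      ≤ |(d.1 : ℝ)| / (2 * N) := by
    refine (abs_max_sub_max_le_max _ _ _ _).trans ?_
    rw [sub_self, abs_zero, max_eq_right (abs_nonneg _), sub_sub_sub_cancel_left, ← sub_div,
      abs_div, abs_of_nonneg (by positivity : (0 : ℝ) ≤ 2 * N)]
    refine div_le_div_of_nonneg_right ?_ (by positivity)
    refine (abs_abs_sub_abs_le _ _).trans (le_of_eq ?_)
    rw [Prod.fst_sub, Int.cast_sub, sub_sub_cancel]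
  have hq : |max 0 (R - |height β (g - d)|) - max 0 (R - |height β g|)| ≤ |height β d| := by
    refine (abs_max_sub_max_le_max _ _ _ _).trans ?_
    rw [sub_self, abs_zero, max_eq_right (abs_nonneg _), sub_sub_sub_cancel_left]
    refine (abs_abs_sub_abs_le _ _).trans (le_of_eq ?_)
    rw [map_sub, sub_sub_cancel]
  have hp1 : max 0 (1 - |((g - d).1 : ℝ)| / (2 * N)) ≤ 1 :=
    max_le zero_le_one (sub_le_self _ (by positivity))
  have hq1 : max 0 (R - |height β g|) ≤ R := max_le hR (sub_le_self _ (abs_nonneg _))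
  set p := max 0 (1 - |((g - d).1 : ℝ)| / (2 * N))
  set p' := max 0 (1 - |(g.1 : ℝ)| / (2 * N))
  set q := max 0 (R - |height β (g - d)|)
  set q' := max 0 (R - |height β g|)
  have hp0 : 0 ≤ p := le_max_left _ _
  have hq0 : 0 ≤ q' := le_max_left _ _
  calc |p * q - p' * q'| = |(p - p') * q' + p * (q - q')| := by ring_nf
    _ ≤ |p - p'| * q' + p * |q - q'| := by
      refine (abs_add_le _ _).trans (le_of_eq ?_)
      rw [abs_mul, abs_mul, abs_of_nonneg hp0, abs_of_nonneg hq0]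
    _ ≤ |(d.1 : ℝ)| / (2 * N) * R + 1 * |height β d| :=
      add_le_add (mul_le_mul hp hq1 hq0 (by positivity))
        (mul_le_mul hp1 hq (abs_nonneg _) zero_le_one)
    _ = _ := by rw [one_mul]

theorem card_box_two_mul_le (β : ℝ) {R : ℝ} (hR : 0 ≤ R) {N : ℕ} (hN : 0 < N) :
    ((box β R (2 * N)).card : ℝ) * (1 / N) ≤ 5 * (2 * R + 1) := by
  have hN' : (1 : ℝ) ≤ N := by exact_mod_cast hN
  have h := card_box_le β hR (2 * N)
  rw [mul_one_div, div_le_iff₀ (by positivity)]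
  refine h.trans ?_
  push_cast
  nlinarith

theorem sum_tentWeight_le (β : ℝ) {R : ℝ} (hR : 0 ≤ R) (N : ℕ) :
    ∑ g ∈ box β R (2 * N), tentWeight β R N g ≤ 5 * (2 * R + 1) * R := by
  rcases Nat.eq_zero_or_pos N with rfl | hN
  · simp only [tentWeight, Nat.cast_zero, div_zero, zero_mul, Finset.sum_const_zero]; positivity
  · calc _ ≤ ∑ g ∈ box β R (2 * N), 1 / N * R := Finset.sum_le_sum fun g _ => tentWeight_le hR N g
      _ = (box β R (2 * N)).card * (1 / N) * R := by rw [Finset.sum_const, nsmul_eq_mul, mul_assoc]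
      _ ≤ _ := mul_le_mul_of_nonneg_right (card_box_two_mul_le β hR hN) hR

/-! ### Tent operators of an orbit and their weak limits -/

section Orbit

variable {H : Type*} [NormedAddCommGroup H] [InnerProductSpace ℂ H]

/-- The weighted sum over `g ∈ E` of the rank one operators `x ↦ ⟪u g, x⟫ u g`. -/
noncomputable def rankOneSum (u : ℤ × ℤ → H) (E : Finset (ℤ × ℤ)) (w : ℤ × ℤ → ℝ) : H →L[ℂ] H :=
  ∑ g ∈ E, (w g : ℂ) • InnerProductSpace.rankOne ℂ (u g) (u g)

theorem rankOneSum_apply (u : ℤ × ℤ → H) (E : Finset (ℤ × ℤ)) (w : ℤ × ℤ → ℝ) (x : H) :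
    rankOneSum u E w x = ∑ g ∈ E, ((w g : ℂ) * inner ℂ (u g) x) • u g := by
  simp [rankOneSum, mul_smul]

theorem norm_sum_smul_le {u : ℤ × ℤ → H} {M : ℝ} (hu : ∀ g, ‖u g‖ ≤ M) (E : Finset (ℤ × ℤ))
    (w : ℤ × ℤ → ℝ) (x : H) :
    ‖∑ g ∈ E, ((w g : ℂ) * inner ℂ (u g) x) • u g‖ ≤ (∑ g ∈ E, |w g|) * (M ^ 2 * ‖x‖) := by
  have hM : 0 ≤ M := (norm_nonneg _).trans (hu 0)
  rw [Finset.sum_mul]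
  refine norm_sum_le_of_le _ fun g _ => ?_
  rw [norm_smul, norm_mul, Complex.norm_real, Real.norm_eq_abs, mul_assoc]
  refine mul_le_mul_of_nonneg_left ?_ (abs_nonneg _)
  calc ‖inner ℂ (u g) x‖ * ‖u g‖ ≤ (‖u g‖ * ‖x‖) * ‖u g‖ :=
        mul_le_mul_of_nonneg_right (norm_inner_le_norm _ _) (norm_nonneg _)
    _ ≤ (M * ‖x‖) * M := by gcongr <;> exact hu g
    _ = _ := by ring

theorem inner_rankOneSum_self (u : ℤ × ℤ → H) (E : Finset (ℤ × ℤ)) (w : ℤ × ℤ → ℝ) (x : H) :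
    inner ℂ (rankOneSum u E w x) x = ((∑ g ∈ E, w g * ‖inner ℂ (u g) x‖ ^ 2 : ℝ) : ℂ) := by
  rw [rankOneSum_apply, sum_inner, Complex.ofReal_sum]
  refine Finset.sum_congr rfl fun g _ => ?_
  rw [inner_smul_left, map_mul, Complex.conj_ofReal, mul_assoc, Complex.conj_mul']
  push_cast
  rfl

/-- Triangle inequality, then weighted Cauchy–Schwarz. It survives in the weak limit as ‖K x‖² ≤ C
⟨K x, x⟩. -/
theorem norm_rankOneSum_sq_le {u : ℤ × ℤ → H} {M : ℝ} (hu : ∀ g, ‖u g‖ ≤ M)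
    (E : Finset (ℤ × ℤ)) {w : ℤ × ℤ → ℝ} (hw : ∀ g, 0 ≤ w g) (x : H) :
    ‖rankOneSum u E w x‖ ^ 2
      ≤ M ^ 2 * (∑ g ∈ E, w g) * ∑ g ∈ E, w g * ‖inner ℂ (u g) x‖ ^ 2 := by
  have h1 : ‖rankOneSum u E w x‖ ≤ M * ∑ g ∈ E, w g * ‖inner ℂ (u g) x‖ := by
    rw [rankOneSum_apply, Finset.mul_sum]
    refine norm_sum_le_of_le _ fun g _ => ?_
    rw [norm_smul, norm_mul, Complex.norm_real, Real.norm_eq_abs, abs_of_nonneg (hw g), mul_comm]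
    exact mul_le_mul_of_nonneg_right (hu g) (mul_nonneg (hw g) (norm_nonneg _))
  have h2 : (∑ g ∈ E, w g * ‖inner ℂ (u g) x‖) ^ 2
      ≤ (∑ g ∈ E, w g) * ∑ g ∈ E, w g * ‖inner ℂ (u g) x‖ ^ 2 := by
    refine Finset.sum_sq_le_sum_mul_sum_of_sq_le_mul _ (fun g _ => hw g)
      (fun g _ => mul_nonneg (hw g) (sq_nonneg _)) fun g _ => le_of_eq (by ring)
  calc _ ≤ (M * ∑ g ∈ E, w g * ‖inner ℂ (u g) x‖) ^ 2 := by gcongr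
    _ = M ^ 2 * (∑ g ∈ E, w g * ‖inner ℂ (u g) x‖) ^ 2 := mul_pow _ _ _
    _ ≤ M ^ 2 * ((∑ g ∈ E, w g) * ∑ g ∈ E, w g * ‖inner ℂ (u g) x‖ ^ 2) := by gcongr
    _ = _ := by ring

/-- Bessel's inequality for each orbit vector; the bound is independent of `s`, so it passes to the
trace of the limit. -/
theorem sum_inner_rankOneSum_le {u : ℤ × ℤ → H} {M : ℝ} (hu : ∀ g, ‖u g‖ ≤ M)
    (E : Finset (ℤ × ℤ)) {w : ℤ × ℤ → ℝ} (hw : ∀ g, 0 ≤ w g) (s : Finset H)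
    (hs : Orthonormal ℂ ((↑) : s → H)) :
    ∑ v ∈ s, (inner ℂ (rankOneSum u E w v) v).re ≤ M ^ 2 * ∑ g ∈ E, w g := by
  simp_rw [inner_rankOneSum_self, Complex.ofReal_re]
  rw [Finset.sum_comm, Finset.mul_sum]
  refine Finset.sum_le_sum fun g _ => ?_
  rw [← Finset.mul_sum, mul_comm]
  refine mul_le_mul_of_nonneg_right ?_ (hw g)
  have h := hs.sum_inner_products_le (u g) (s := Finset.univ)
  rw [Finset.univ_eq_attach, Finset.sum_attach s fun v => ‖inner ℂ v (u g)‖ ^ 2] at h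
  simp_rw [norm_inner_symm (u g)]
  exact h.trans (pow_le_pow_left₀ (norm_nonneg _) (hu g) 2)

variable (U : ℤ × ℤ → H →ₗᵢ[ℂ] H)

theorem inner_orbit (hU : ∀ g h x, U (g + h) x = U g (U h x)) (g h : ℤ × ℤ) (x y : H) :
    inner ℂ (U g x) (U h y) = inner ℂ (U (g - h) x) y := by
  conv_lhs => rw [← add_sub_cancel h g, hU, (U h).inner_map_map]

theorem orbit_neg_cancel (hU : ∀ g h x, U (g + h) x = U g (U h x)) (d : ℤ × ℤ) (x : H) :
    U d (U (-d) x) = x := by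
  rw [← hU, add_neg_cancel]
  exact (U 0).injective (by rw [← hU, add_zero])

/-- The commutator of a weighted rank one sum along an orbit with the representation is
controlled by the translation defect of the weight. -/
theorem norm_orbit_rankOneSum_sub_le (hU : ∀ g h x, U (g + h) x = U g (U h x)) (f x : H)
    {E : Finset (ℤ × ℤ)} {w : ℤ × ℤ → ℝ} (hw : ∀ g, g ∉ E → w g = 0) (d : ℤ × ℤ) :
    ‖U d (rankOneSum (fun g => U g f) E w x) - rankOneSum (fun g => U g f) E w (U d x)‖
      ≤ (∑ g ∈ E ∪ E.image (· + d), |w (g - d) - w g|) * (‖f‖ ^ 2 * ‖x‖) := by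
  -- Shifting the summation index by `d` moves the translation from the vectors to the weight.
  have h1 : U d (rankOneSum (fun g => U g f) E w x)
      = ∑ g ∈ E ∪ E.image (· + d), ((w (g - d) : ℂ) * inner ℂ (U g f) (U d x)) • U g f := by
    rw [← Finset.sum_subset (Finset.subset_union_right (s₁ := E)),
      Finset.sum_image (fun a _ b _ h => add_right_cancel h), rankOneSum_apply, map_sum]
    · refine Finset.sum_congr rfl fun g _ => ?_
      rw [add_sub_cancel_right, map_smul, add_comm g d, hU, (U d).inner_map_map]
    · intro g _ hg
      rw [hw (g - d) fun h => hg (Finset.mem_image.2 ⟨_, h, sub_add_cancel g d⟩)]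
      simp
  have h2 : rankOneSum (fun g => U g f) E w (U d x)
      = ∑ g ∈ E ∪ E.image (· + d), ((w g : ℂ) * inner ℂ (U g f) (U d x)) • U g f := by
    rw [rankOneSum_apply]
    refine Finset.sum_subset Finset.subset_union_left fun g _ hg => ?_
    rw [hw g hg]
    simp
  rw [h1, h2, ← Finset.sum_sub_distrib]
  have h3 := norm_sum_smul_le (u := fun g => U g f) (fun g => ((U g).norm_map f).le)
    (E ∪ E.image (· + d)) (fun g => w (g - d) - w g) (U d x)
  rw [(U d).norm_map] at h3
  refine le_trans (le_of_eq ?_) h3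
  congr 1
  refine Finset.sum_congr rfl fun g _ => ?_
  rw [← sub_smul, ← sub_mul, Complex.ofReal_sub]

/-- The operators averaging the rank one projections of an orbit against tent weights. -/
noncomputable def tentOperator (β R : ℝ) (f : H) (N : ℕ) : H →L[ℂ] H :=
  rankOneSum (fun g => U g f) (box β R (2 * N)) (tentWeight β R N)

/-- The number of points in the box and its translate is O(N), which cancels the factor 1/N in the
pointwise defect; the constant 10 is 2 for the union times 5 from `card_box_two_mul_le`. -/
theorem norm_orbit_tentOperator_sub_le (hU : ∀ g h x, U (g + h) x = U g (U h x)) (β : ℝ) {R : ℝ}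
    (hR : 0 ≤ R) (f x : H) {N : ℕ} (hN : 0 < N) (d : ℤ × ℤ) :
    ‖U d (tentOperator U β R f N x) - tentOperator U β R f N (U d x)‖
      ≤ 10 * (2 * R + 1) * (|(d.1 : ℝ)| / (2 * N) * R + |height β d|) * (‖f‖ ^ 2 * ‖x‖) := by
  refine (norm_orbit_rankOneSum_sub_le U hU f x (fun g hg => tentWeight_eq_zero hg) d).trans ?_
  refine mul_le_mul_of_nonneg_right ?_ (by positivity)
  have hcard : ((box β R (2 * N) ∪ (box β R (2 * N)).image (· + d)).card : ℝ)
      ≤ 2 * (box β R (2 * N)).card := by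
    have h1 := Finset.card_union_le (box β R (2 * N)) ((box β R (2 * N)).image (· + d))
    have h2 := Finset.card_image_le (s := box β R (2 * N)) (f := (· + d))
    exact_mod_cast (by omega : _ ≤ 2 * (box β R (2 * N)).card)
  calc _ ≤ ∑ g ∈ box β R (2 * N) ∪ (box β R (2 * N)).image (· + d),
          1 / N * (|(d.1 : ℝ)| / (2 * N) * R + |height β d|) :=
        Finset.sum_le_sum fun g _ => abs_tentWeight_sub_le hR N g d
    _ ≤ 2 * (box β R (2 * N)).card * (1 / N * (|(d.1 : ℝ)| / (2 * N) * R + |height β d|)) := by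
        rw [Finset.sum_const, nsmul_eq_mul]
        exact mul_le_mul_of_nonneg_right hcard (by positivity)
    _ = 2 * ((box β R (2 * N)).card * (1 / N)) * (|(d.1 : ℝ)| / (2 * N) * R + |height β d|) := by
        ring
    _ ≤ 2 * (5 * (2 * R + 1)) * (|(d.1 : ℝ)| / (2 * N) * R + |height β d|) := by
        have := card_box_two_mul_le β hR hN
        gcongr
    _ = _ := by ring

/-- Every vector in the range of a weak limit of the tent operators has a totally bounded orbit
along each strip. -/
theorem totallyBounded_orbit_of_tendsto (hU : ∀ g h x, U (g + h) x = U g (U h x)) (β c : ℝ)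
    {R : ℝ} (hR : 0 < R) (f : H) {𝓕 : Filter ℕ} [𝓕.NeBot] (h𝓕 : 𝓕 ≤ atTop) {K : H →L[ℂ] H}
    (hK : ∀ x y, Tendsto (fun N => inner ℂ (tentOperator U β R f N x) y) 𝓕 (𝓝 (inner ℂ (K x) y)))
    (x : H) :
    TotallyBounded ((fun g => U g (K x)) '' strip β c) := by
  have hW0 : 0 < 5 * (2 * R + 1) * R := by positivity
  set W : ℝ := 5 * (2 * R + 1) * R
  -- The commutator bound passes to the limit by weak lower semicontinuity of the norm.
  have hcomm : ∀ d, ‖U d (K x) - K (U d x)‖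
      ≤ 10 * (2 * R + 1) * (0 * R + |height β d|) * (‖f‖ ^ 2 * ‖x‖) := by
    intro d
    have hM : Tendsto (fun N : ℕ => 10 * (2 * R + 1) * (|(d.1 : ℝ)| / (2 * N) * R + |height β d|)
        * (‖f‖ ^ 2 * ‖x‖)) 𝓕
        (𝓝 (10 * (2 * R + 1) * (0 * R + |height β d|) * (‖f‖ ^ 2 * ‖x‖))) := by
      have h0 : Tendsto (fun N : ℕ => |(d.1 : ℝ)| / (2 * N)) atTop (𝓝 0) :=
        tendsto_const_nhds.div_atTop
          (tendsto_natCast_atTop_atTop.const_mul_atTop (by norm_num))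
      exact ((((h0.mul_const R).add_const _).const_mul _).mul_const _).mono_left h𝓕
    refine norm_le_of_tendsto_inner (z := fun N => U d (tentOperator U β R f N x) -
      tentOperator U β R f N (U d x)) ?_ hM ?_
    · set y := U d (K x) - K (U d x) with hy
      have h1 : ∀ a, inner ℂ (U d a) y = inner ℂ a (U (-d) y) := fun a => by
        conv_lhs => rw [← orbit_neg_cancel U hU d y, (U d).inner_map_map]
      have h2 := (hK x (U (-d) y)).sub (hK (U d x) y)
      rw [← h1, ← inner_sub_left, ← hy] at h2
      refine h2.congr fun N => ?_
      rw [inner_sub_left, h1]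
    · filter_upwards [h𝓕 (eventually_gt_atTop 0)] with N hN
      exact norm_orbit_tentOperator_sub_le U hU β hR.le f x hN d
  have hball : TotallyBounded (K '' Metric.closedBall 0 (‖x‖ + 1)) := by
    have hself : ∀ x, Tendsto (fun N => (inner ℂ (tentOperator U β R f N x) x).re) 𝓕
        (𝓝 (inner ℂ (K x) x).re) := fun x => (Complex.continuous_re.tendsto _).comp (hK x x)
    refine totallyBounded_image_closedBall_of_trace_le K (C := (‖f‖ ^ 2 + 1) * W)
      (D := (‖f‖ ^ 2 + 1) * W) (by positivity) ?_ ?_ (by positivity)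
    · intro x
      have hM := ((hself x).const_mul ((‖f‖ ^ 2 + 1) * W)).sqrt
      have h1 : ‖K x‖ ≤ √((‖f‖ ^ 2 + 1) * W * (inner ℂ (K x) x).re) := by
        refine norm_le_of_tendsto_inner (hK x (K x)) hM (Eventually.of_forall fun N => ?_)
        refine Real.le_sqrt_of_sq_le ?_
        refine (norm_rankOneSum_sq_le (u := fun g => U g f) (fun g => ((U g).norm_map f).le) _
          (tentWeight_nonneg β R N) x).trans ?_
        rw [tentOperator, inner_rankOneSum_self, Complex.ofReal_re]
        refine mul_le_mul_of_nonneg_right ?_ (Finset.sum_nonneg fun g _ =>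
          mul_nonneg (tentWeight_nonneg β R N g) (sq_nonneg _))
        exact mul_le_mul (by linarith) (sum_tentWeight_le β hR.le N)
          (Finset.sum_nonneg fun g _ => tentWeight_nonneg β R N g) (by positivity)
      have h2 : 0 ≤ (inner ℂ (K x) x).re := ge_of_tendsto (hself x) (Eventually.of_forall fun N => by
        rw [tentOperator, inner_rankOneSum_self, Complex.ofReal_re]
        exact Finset.sum_nonneg fun g _ => mul_nonneg (tentWeight_nonneg β R N g) (sq_nonneg _))
      rwa [Real.le_sqrt (norm_nonneg _) (by positivity)] at h1
    · intro s hs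
      refine le_of_tendsto (tendsto_finsetSum s fun v _ => hself v) (Eventually.of_forall fun N => ?_)
      refine (sum_inner_rankOneSum_le (u := fun g => U g f) (fun g => ((U g).norm_map f).le) _
        (tentWeight_nonneg β R N) s hs).trans ?_
      exact mul_le_mul (by linarith) (sum_tentWeight_le β hR.le N)
          (Finset.sum_nonneg fun g _ => tentWeight_nonneg β R N g) (by positivity)
  rw [Metric.totallyBounded_iff]
  intro ε hε
  -- `B` dominates the commutator constant; the added 1 keeps it positive, so that one may divide by
  -- it.
  set B : ℝ := 10 * (2 * R + 1) * (‖f‖ ^ 2 * ‖x‖) + 1 with hB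
  have hBpos : 0 < B := by positivity
  obtain ⟨F, -, hF⟩ := exists_finset_height_net β c (show 0 < ε / 2 / B by positivity)
  have hunion : TotallyBounded (⋃ h ∈ F, U h '' (K '' Metric.closedBall 0 (‖x‖ + 1))) :=
    (totallyBounded_biUnion F.finite_toSet).2 fun h _ => hball.image (U h).isometry.uniformContinuous
  obtain ⟨t, htf, ht⟩ := Metric.totallyBounded_iff.1 hunion (ε / 2) (half_pos hε)
  refine ⟨t, htf, ?_⟩
  rintro _ ⟨g, hg, rfl⟩
  obtain ⟨h, hh, hgh⟩ := hF g hg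
  -- With `h` of nearly the same height as `g`, U^g K x = U^h U^(g-h) K x is close to U^h K U^(g-h)
  -- x, a point in one of finitely many isometric copies of a totally bounded set.
  have hmem : U h (K (U (g - h) x)) ∈ ⋃ h ∈ F, U h '' (K '' Metric.closedBall 0 (‖x‖ + 1)) := by
    refine Set.mem_iUnion₂.2 ⟨h, hh, _, ⟨_, ?_, rfl⟩, rfl⟩
    rw [mem_closedBall_zero_iff, (U (g - h)).norm_map]
    linarith
  obtain ⟨y, hy, hyt⟩ := Set.mem_iUnion₂.1 (ht hmem)
  refine Set.mem_iUnion₂.2 ⟨y, hy, ?_⟩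
  have hd : dist (U g (K x)) (U h (K (U (g - h) x))) < ε / 2 := by
    conv_lhs => rw [← add_sub_cancel h g, hU, (U h).isometry.dist_eq, dist_eq_norm,
      add_sub_cancel]
    calc _ ≤ _ := hcomm (g - h)
      _ ≤ B * |height β (g - h)| := by
        rw [hB]; nlinarith [abs_nonneg (height β (g - h))]
      _ < B * (ε / 2 / B) := by gcongr
      _ = ε / 2 := by field_simp
  rw [Metric.mem_ball] at hyt ⊢
  linarith [dist_triangle (U g (K x)) (U h (K (U (g - h) x))) y]

/-- If a vector is orthogonal to all vectors with totally bounded orbits along a strip, then its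
squared correlations tend to zero on average along strips. -/
theorem tendsto_sum_tentWeight_mul_sq [CompleteSpace H] (hU : ∀ g h x, U (g + h) x = U g (U h x))
    (β c : ℝ) {R : ℝ} (hR : 0 < R) (f : H)
    (hf : ∀ x, TotallyBounded ((fun g => U g x) '' strip β c) → inner ℂ x f = 0) :
    Tendsto (fun N : ℕ => ∑ g ∈ box β R (2 * N), tentWeight β R N g * ‖inner ℂ (U g f) f‖ ^ 2)
      atTop (𝓝 0) := by
  rw [tendsto_iff_ultrafilter]
  intro 𝒰 h𝒰
  obtain ⟨K, hK⟩ := exists_tendsto_inner_of_norm_le (tentOperator U β R f)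
    (C := 5 * (2 * R + 1) * R * ‖f‖ ^ 2) (fun N => by
      refine ContinuousLinearMap.opNorm_le_bound _ (by positivity) fun x => ?_
      rw [tentOperator, rankOneSum_apply]
      refine (norm_sum_smul_le (u := fun g => U g f) (fun g => ((U g).norm_map f).le) _ _ x).trans ?_
      rw [mul_assoc]
      refine mul_le_mul_of_nonneg_right ?_ (by positivity)
      simp_rw [abs_of_nonneg (tentWeight_nonneg β R N _)]
      exact sum_tentWeight_le β hR.le N) 𝒰
  have h1 := (Complex.continuous_re.tendsto _).comp (hK f f)
  rw [hf _ (totallyBounded_orbit_of_tendsto U hU β c hR f h𝒰 hK f), Complex.zero_re] at h1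
  refine h1.congr fun N => ?_
  rw [Function.comp_apply, tentOperator, inner_rankOneSum_self, Complex.ofReal_re]

end Orbit

/-! ### Norm averages along sequences in a strip -/

/-- Averages along a linearly growing injective sequence in a strip kill every vector that is
orthogonal to all vectors with totally bounded orbits along a strip. -/
theorem tendsto_norm_average_orbit {H : Type*} [NormedAddCommGroup H] [InnerProductSpace ℂ H]
    [CompleteSpace H] (U : ℤ × ℤ → H →ₗᵢ[ℂ] H) (hU : ∀ g h x, U (g + h) x = U g (U h x))
    {β b : ℝ} (hb : 0 < b) (c : ℝ) (f : H)
    (hf : ∀ x, TotallyBounded ((fun g => U g x) '' strip β c) → inner ℂ x f = 0)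
    {q : ℕ → ℤ × ℤ} (hinj : Function.Injective q) (hq : ∀ i, q i ∈ strip β b) {D : ℕ}
    (hD : 0 < D) (hqD : ∀ i, |(q i).1| ≤ D * (i + 1)) :
    Tendsto (fun N : ℕ => ‖(1 / (N : ℂ)) • ∑ i ∈ Finset.range N, U (q i) f‖) atTop (𝓝 0) := by
  set S : ℕ → ℝ := fun N =>
    ∑ g ∈ box β (b + 1) (2 * N), tentWeight β (b + 1) N g * ‖inner ℂ (U g f) f‖ ^ 2 with hS
  have hlim : Tendsto (fun N : ℕ => √√(4 * D * S (2 * D * N))) atTop (𝓝 0) := by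
    have h1 := tendsto_sum_tentWeight_mul_sq U hU β c (by linarith : 0 < b + 1) f hf
    have h2 : Tendsto (fun N : ℕ => 2 * D * N) atTop atTop :=
      tendsto_id.const_mul_atTop' (by positivity)
    simpa using (((h1.comp h2).const_mul (4 * D : ℝ)).sqrt).sqrt
  refine squeeze_zero' (Eventually.of_forall fun N => norm_nonneg _) ?_ hlim
  filter_upwards [eventually_gt_atTop 0] with N hN
  have hN' : (0 : ℝ) < N := by exact_mod_cast hN
  have hD' : (0 : ℝ) < D := by exact_mod_cast hD
  have hM : 0 < 2 * D * N := by positivity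
  set a : ℤ × ℤ → ℝ := fun g => ‖inner ℂ (U g f) f‖ ^ 2 with ha
  -- For fixed `j` the differences `q i - q j` are distinct points of a box of length 2DN, where the
  -- tent weight is at least 1/(4DN).
  have hcol : ∀ j ∈ Finset.range N,
      ∑ i ∈ Finset.range N, a (q i - q j) ≤ 4 * D * N * S (2 * D * N) := by
    intro j hj
    have hbox : ∀ i ∈ Finset.range N, q i - q j ∈ box β b (2 * D * N) := by
      intro i hi
      rw [Finset.mem_range] at hi hj
      rw [mem_box]
      constructor
      · have h1 := hqD i
        have h2 := hqD j
        have h3 : (D : ℤ) * (i + 1) ≤ D * N := by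
          refine mul_le_mul_of_nonneg_left ?_ (by positivity); omega
        have h4 : (D : ℤ) * (j + 1) ≤ D * N := by
          refine mul_le_mul_of_nonneg_left ?_ (by positivity); omega
        have h5 := abs_sub (q i).1 (q j).1
        rw [Prod.fst_sub]
        push_cast
        linarith
      · have := mem_strip_iff.1 (sub_mem_strip (hq i) (hq j))
        linarith
    have hpt : ∀ i ∈ Finset.range N, a (q i - q j)
        ≤ 4 * D * N * (tentWeight β (b + 1) (2 * D * N) (q i - q j) * a (q i - q j)) := by
      intro i hi
      have h1 := le_tentWeight hM (hbox i hi)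
      rw [div_le_iff₀ (by positivity)] at h1
      push_cast at h1
      have h2 : 0 ≤ a (q i - q j) := sq_nonneg _
      nlinarith
    refine (Finset.sum_le_sum hpt).trans ?_
    rw [← Finset.mul_sum]
    refine mul_le_mul_of_nonneg_left ?_ (by positivity)
    have hinj' : Set.InjOn (fun i => q i - q j) (Finset.range N) :=
      fun i _ i' _ h => hinj (sub_left_injective h)
    rw [← Finset.sum_image (f := fun g => tentWeight β (b + 1) (2 * D * N) g * a g) hinj']
    refine Finset.sum_le_sum_of_subset_of_nonneg ?_ fun g _ _ =>
      mul_nonneg (tentWeight_nonneg _ _ _ _) (sq_nonneg _)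
    intro g hg
    obtain ⟨i, hi, rfl⟩ := Finset.mem_image.1 hg
    have h1 := mem_box.1 (hbox i hi)
    refine mem_box.2 ⟨h1.1.trans ?_, by linarith [h1.2]⟩
    push_cast
    nlinarith [Int.natCast_nonneg (D * N)]
  have hsum : ‖∑ i ∈ Finset.range N, U (q i) f‖ ^ 2
      ≤ ∑ p ∈ Finset.range N ×ˢ Finset.range N, ‖inner ℂ (U (q p.2 - q p.1) f) f‖ := by
    rw [← Complex.ofReal_re (‖∑ i ∈ Finset.range N, U (q i) f‖ ^ 2), Complex.ofReal_pow]
    have h1 := inner_self_eq_norm_sq_to_K (𝕜 := ℂ) (∑ i ∈ Finset.range N, U (q i) f)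
    rw [show ((‖∑ i ∈ Finset.range N, U (q i) f‖ : ℝ) : ℂ) ^ 2
      = inner ℂ (∑ i ∈ Finset.range N, U (q i) f) (∑ i ∈ Finset.range N, U (q i) f) from h1.symm]
    refine (Complex.re_le_norm _).trans ?_
    rw [sum_inner, Finset.sum_product_right]
    refine norm_sum_le_of_le _ fun i _ => ?_
    rw [inner_sum]
    refine norm_sum_le_of_le _ fun j _ => ?_
    rw [inner_orbit U hU]
  have hcs : (∑ p ∈ Finset.range N ×ˢ Finset.range N, ‖inner ℂ (U (q p.2 - q p.1) f) f‖) ^ 2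
      ≤ (N * N : ℝ) * (N * (4 * D * N * S (2 * D * N))) := by
    refine sq_sum_le_card_mul_sum_sq.trans ?_
    rw [Finset.card_product, Finset.card_range, Nat.cast_mul]
    refine mul_le_mul_of_nonneg_left ?_ (by positivity)
    rw [Finset.sum_product]
    refine (Finset.sum_le_sum hcol).trans ?_
    rw [Finset.sum_const, Finset.card_range, nsmul_eq_mul]
  have hfour : ‖(1 / (N : ℂ)) • ∑ i ∈ Finset.range N, U (q i) f‖ ^ 4 ≤ 4 * D * S (2 * D * N) := by
    rw [norm_smul, norm_div, norm_one, Complex.norm_natCast, mul_pow]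
    have h1 : ‖∑ i ∈ Finset.range N, U (q i) f‖ ^ 4
        ≤ (N * N : ℝ) * (N * (4 * D * N * S (2 * D * N))) := by
      refine le_trans ?_ hcs
      calc _ = (‖∑ i ∈ Finset.range N, U (q i) f‖ ^ 2) ^ 2 := by ring
        _ ≤ _ := pow_le_pow_left₀ (sq_nonneg _) hsum 2
    calc _ ≤ (1 / (N : ℝ)) ^ 4 * ((N * N : ℝ) * (N * (4 * D * N * S (2 * D * N)))) := by gcongr
      _ = _ := by field_simp
  refine Real.le_sqrt_of_sq_le (Real.le_sqrt_of_sq_le ?_)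
  calc _ = ‖(1 / (N : ℂ)) • ∑ i ∈ Finset.range N, U (q i) f‖ ^ 4 := by ring
    _ ≤ _ := hfour

/-! ### Growth and existence of ordered enumerations -/

/-- An ordered enumeration of a set of positive lower density in a strip grows at most linearly. -/
theorem exists_abs_fst_le_mul {β b : ℝ} (hb : 0 < b) {Q : Set (ℤ × ℤ)}
    (hdens : 0 < lowerRelDensity β b Q) {q : ℕ → ℤ × ℤ} (hq : IsOrderedEnumeration Q q) :
    ∃ D : ℕ, 0 < D ∧ ∀ i, |(q i).1| ≤ D * (i + 1) := by
  obtain ⟨δ₁, hδ₁, hlt⟩ := exists_between hdens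
  have h1 := eventually_lt_of_lt_liminf hlt
    (isBoundedUnder_of ⟨0, fun k => by positivity⟩)
  obtain ⟨δ₂, hδ₂, h2⟩ := exists_linear_le_ncard_strip β hb
  obtain ⟨k₀, hk₀⟩ := eventually_atTop.1 (h1.and h2)
  have hδ : 0 < δ₁ * δ₂ := mul_pos hδ₁ hδ₂
  obtain ⟨n, hn⟩ := exists_nat_gt (1 / (δ₁ * δ₂))
  refine ⟨k₀ + n + 1, by omega, fun i => ?_⟩
  set M := (q i).1.natAbs with hM
  have habs : |(q i).1| = (M : ℤ) := Int.abs_eq_natAbs _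
  rw [habs]
  norm_cast
  rcases lt_or_ge M (k₀ + 1) with h | h
  · nlinarith
  obtain ⟨h3, h4⟩ := hk₀ M (by omega)
  have hMpos : (0 : ℝ) < M := by exact_mod_cast (by omega : 0 < M)
  have hstrip : (0 : ℝ) < (strip β b ∩ slab M).ncard := lt_of_lt_of_le (by positivity) h4
  rw [lt_div_iff₀ hstrip] at h3
  -- The slab ends at `M - 1`, so its points have first coordinate strictly below |(q i).1| and must
  -- be listed before index `i`.
  have hcard : (Q ∩ slab M).ncard ≤ i := by
    have hsub : Q ∩ slab M ⊆ q '' (Finset.range i : Set ℕ) := by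
      rintro g ⟨hg, h5, h6⟩
      rw [← hq.range_eq] at hg
      obtain ⟨j, rfl⟩ := hg
      refine ⟨j, ?_, rfl⟩
      rw [Finset.coe_range, Set.mem_Iio]
      by_contra hij
      have := hq.monotone_abs (not_lt.1 hij)
      dsimp only at this
      rw [habs, abs_of_nonneg h5] at this
      omega
    calc _ ≤ (q '' (Finset.range i : Set ℕ)).ncard :=
          Set.ncard_le_ncard hsub ((Finset.finite_toSet _).image q)
      _ ≤ (Finset.range i : Set ℕ).ncard := Set.ncard_image_le (Finset.finite_toSet _)
      _ = i := by rw [Set.ncard_coe_finset, Finset.card_range]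
  have hcard' : ((Q ∩ slab M).ncard : ℝ) ≤ i := by exact_mod_cast hcard
  have h7 : δ₁ * δ₂ * M ≤ i := by nlinarith
  have h8 : (M : ℝ) ≤ n * i := by
    have : (M : ℝ) ≤ 1 / (δ₁ * δ₂) * i := by
      rw [div_mul_eq_mul_div, one_mul, le_div_iff₀ hδ]; linarith
    exact this.trans (by gcongr)
  have h9 : M ≤ n * i := by exact_mod_cast h8
  nlinarith

/-- An infinite set with at most one point in each column, all in the right half plane, has an
ordered enumeration. -/
theorem exists_isOrderedEnumeration {Q : Set (ℤ × ℤ)} (hinf : Q.Infinite)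
    (hnonneg : ∀ g ∈ Q, 0 ≤ g.1) (hinj : Set.InjOn Prod.fst Q) :
    ∃ q : ℕ → ℤ × ℤ, IsOrderedEnumeration Q q := by
  set P : ℕ → Prop := fun m => ∃ n : ℤ, ((m : ℤ), n) ∈ Q with hP
  have hPfst : ∀ g ∈ Q, P g.1.toNat := fun g hg => ⟨g.2, by
    rw [Int.toNat_of_nonneg (hnonneg g hg)]; exact hg⟩
  have hPinf : (Set.ofPred P).Infinite := by
    have h1 : Set.InjOn (fun g : ℤ × ℤ => g.1.toNat) Q := fun g hg h hh hgh => hinj hg hh (by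
      have := hnonneg g hg
      have := hnonneg h hh
      dsimp only at hgh
      omega)
    refine (hinf.image h1).mono ?_
    rintro _ ⟨g, hg, rfl⟩
    exact hPfst g hg
  choose! n hn using (fun m hm => hm : ∀ m, P m → ∃ n : ℤ, ((m : ℤ), n) ∈ Q)
  have hmem : ∀ i, ((Nat.nth P i : ℤ), n (Nat.nth P i)) ∈ Q :=
    fun i => hn _ (Nat.nth_mem_of_infinite hPinf i)
  refine ⟨fun i => (Nat.nth P i, n (Nat.nth P i)), ?_, ?_, ?_⟩
  · intro i j hij
    have h := congrArg Prod.fst hij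
    exact Nat.nth_injective hPinf (Int.ofNat_inj.1 h)
  · refine Set.Subset.antisymm ?_ fun g hg => ?_
    · rintro _ ⟨i, rfl⟩; exact hmem i
    · have h1 : g.1.toNat ∈ Set.range (Nat.nth P) := by
        rw [Nat.range_nth_of_infinite hPinf]; exact hPfst g hg
      obtain ⟨i, hi⟩ := h1
      refine ⟨i, hinj (hmem i) hg ?_⟩
      dsimp only
      rw [hi, Int.toNat_of_nonneg (hnonneg g hg)]
  · intro i j hij
    dsimp only
    rw [abs_of_nonneg (by positivity), abs_of_nonneg (by positivity)]
    exact_mod_cast Nat.nth_monotone hPinf hij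

/-! ### Total boundedness, and criteria for being constant -/

/-- Total boundedness is transported along maps that are uniformly controlled by another map. -/
theorem totallyBounded_image_of_dist_control {ι E F : Type*} [PseudoMetricSpace E]
    [PseudoMetricSpace F] {u : ι → E} {v : ι → F} {s : Set ι} (hu : TotallyBounded (u '' s))
    (h : ∀ ε > 0, ∃ δ > 0, ∀ i ∈ s, ∀ j ∈ s, dist (u i) (u j) < δ → dist (v i) (v j) < ε) :
    TotallyBounded (v '' s) := by
  rw [Metric.totallyBounded_iff]
  intro ε hε
  obtain ⟨δ, hδ, hδε⟩ := h ε hε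
  obtain ⟨t, hts, htf, htc⟩ := Metric.finite_approx_of_totallyBounded hu δ hδ
  choose p hps hpu using fun y : t => hts y.2
  have := htf.to_subtype
  refine ⟨Set.range fun y => v (p y), Set.finite_range _, ?_⟩
  rintro _ ⟨i, hi, rfl⟩
  obtain ⟨y, hy, hiy⟩ := Set.mem_iUnion₂.1 (htc (Set.mem_image_of_mem u hi))
  refine Set.mem_iUnion₂.2 ⟨_, Set.mem_range_self ⟨y, hy⟩, hδε i hi _ (hps _) ?_⟩
  rw [hpu]
  exact hiy

section Constants

variable {X : Type*} [MeasurableSpace X] (μ : Measure X) [IsProbabilityMeasure μ]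

theorem inner_const_left (a : ℂ) (f : Lp ℂ 2 μ) :
    inner ℂ (Lp.const 2 μ a) f = inner ℂ a (∫ x, f x ∂μ) := by
  rw [← indicatorConstLp_univ, L2.inner_indicatorConstLp_eq_inner_setIntegral, setIntegral_univ]

theorem integral_sub_const_integral (f : Lp ℂ 2 μ) :
    ∫ x, (f - Lp.const 2 μ (∫ x, f x ∂μ) : Lp ℂ 2 μ) x ∂μ = 0 := by
  have hf : Integrable f μ := (Lp.memLp f).integrable (by norm_num)
  rw [integral_congr_ae ((Lp.coeFn_sub f _).trans ((ae_eq_refl _).sub (Lp.coeFn_const _ _ _)))]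
  simp only [Pi.sub_apply, Function.const_apply]
  rw [integral_sub hf (integrable_const _), integral_const]
  simp

/-- A real function whose superlevel sets, at levels without mass, are trivial is constant. -/
theorem exists_ae_eq_const_of_superlevel {ψ : X → ℝ} (hψ : Measurable ψ)
    (h : ∀ a, μ {x | ψ x = a} = 0 →
      {x | a < ψ x} =ᵐ[μ] (∅ : Set X) ∨ {x | a < ψ x} =ᵐ[μ] (Set.univ : Set X)) :
    ∃ a, ψ =ᵐ[μ] Function.const X a := by
  -- Only countably many levels carry mass, so the remaining ones contain a countable dense set,
  -- whose half-lines separate real numbers.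
  have hdense : Dense {a | 0 < μ {x | ψ x = a}}ᶜ :=
    (Measure.countable_meas_level_set_pos hψ).dense_compl ℝ
  obtain ⟨D, hDsub, hDc, hDd⟩ := hdense.exists_countable_dense_subset
  have : HasCountableSeparatingOn ℝ (fun s => ∃ a ∈ D, s = Set.Ioi a) Set.univ := by
    refine ⟨Set.Ioi '' D, hDc.image _, ?_, ?_⟩
    · rintro _ ⟨a, ha, rfl⟩; exact ⟨a, ha, rfl⟩
    · intro x _ y _ hxy
      by_contra hne
      rcases lt_or_gt_of_ne hne with hlt | hlt
      · obtain ⟨a, ha, h1, h2⟩ := hDd.exists_between hlt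
        exact absurd ((hxy _ ⟨a, ha, rfl⟩).2 h2) (not_lt.2 h1.le)
      · obtain ⟨a, ha, h1, h2⟩ := hDd.exists_between hlt
        exact absurd ((hxy _ ⟨a, ha, rfl⟩).1 h2) (not_lt.2 h1.le)
  refine exists_eventuallyEq_const_of_forall_separating (l := ae μ)
    (fun s => ∃ a ∈ D, s = Set.Ioi a) ?_
  rintro _ ⟨a, ha, rfl⟩
  have ha0 : μ {x | ψ x = a} = 0 := by
    have := hDsub ha
    rw [Set.mem_compl_iff] at this
    exact nonpos_iff_eq_zero.1 (not_lt.1 this)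
  rcases h a ha0 with h1 | h1
  · right; exact eventuallyEq_empty.1 h1
  · left; exact eventuallyEq_univ.1 h1

theorem ae_eq_empty_or_univ_of_indicator_eq_const {B : Set X} (hB : MeasurableSet B) {a : ℂ}
    (h : indicatorConstLp 2 hB (measure_ne_top μ B) (1 : ℂ) = Lp.const 2 μ a) :
    B =ᵐ[μ] (∅ : Set X) ∨ B =ᵐ[μ] (Set.univ : Set X) := by
  have h1 : ∀ᵐ x ∂μ, B.indicator (fun _ => (1 : ℂ)) x = a := by
    filter_upwards [indicatorConstLp_coeFn (p := 2) (hs := hB) (hμs := measure_ne_top μ B)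
      (c := (1 : ℂ)), Lp.coeFn_const 2 μ a] with x h2 h3
    rw [← h2, h, h3, Function.const_apply]
  rcases eq_or_ne a 1 with rfl | ha
  · right
    refine eventuallyEq_univ.2 (h1.mono fun x hx => ?_)
    by_contra hxB
    rw [Set.indicator_of_notMem hxB] at hx
    exact zero_ne_one hx
  · left
    refine eventuallyEq_empty.2 (h1.mono fun x hx hxB => ?_)
    rw [Set.indicator_of_mem hxB] at hx
    exact ha hx.symm

end Constants

/-! ### The Koopman representation and the Kronecker algebra -/

section Koopman

variable {X : Type*} [MeasurableSpace X] [AddAction (ℤ × ℤ) X] [MeasurableConstVAdd (ℤ × ℤ) X]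
  (μ : Measure X) [VAddInvariantMeasure (ℤ × ℤ) X μ]

/-- The Koopman operator as a linear isometry. -/
noncomputable def koopmanIsometry (g : ℤ × ℤ) : Lp ℂ 2 μ →ₗᵢ[ℂ] Lp ℂ 2 μ :=
  Lp.compMeasurePreservingₗᵢ ℂ (fun x : X => g +ᵥ x) (measurePreserving_vadd g μ)

theorem koopmanIsometry_apply (g : ℤ × ℤ) (f : Lp ℂ 2 μ) :
    koopmanIsometry μ g f = koopman μ g f := rfl

theorem koopmanIsometry_add (g h : ℤ × ℤ) (f : Lp ℂ 2 μ) :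
    koopmanIsometry μ (g + h) f = koopmanIsometry μ g (koopmanIsometry μ h f) := by
  have hcomp := Lp.compMeasurePreserving_comp_apply f (measurePreserving_vadd h μ)
    (measurePreserving_vadd g μ)
  simp only [koopmanIsometry_apply, koopman]
  rw [← hcomp]
  congr 2
  funext x
  -- Composition reverses the order of the group elements; commutativity of ℤ² restores it.
  rw [Function.comp_apply, vadd_vadd, add_comm]

theorem koopman_sub (g : ℤ × ℤ) (f f' : Lp ℂ 2 μ) :
    koopman μ g (f - f') = koopman μ g f - koopman μ g f' :=
  map_sub (koopmanIsometry μ g) f f'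

theorem dist_koopman_koopman (g h : ℤ × ℤ) (f : Lp ℂ 2 μ) :
    dist (koopman μ g f) (koopman μ h f) = dist (koopman μ (g - h) f) f := by
  simp only [← koopmanIsometry_apply]
  conv_lhs => rw [← add_sub_cancel h g, koopmanIsometry_add, (koopmanIsometry μ h).isometry.dist_eq]

variable [IsProbabilityMeasure μ]

theorem koopman_const (g : ℤ × ℤ) (a : ℂ) :
    koopman μ g (Lp.const 2 μ a) = Lp.const 2 μ a := rfl

/-- L² is complete, so a closed totally bounded set is compact. -/
theorem mem_kroneckerAlgebra_iff {β c : ℝ} {B : Set X} :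
    B ∈ kroneckerAlgebra μ β c ↔ ∃ hB : MeasurableSet B, TotallyBounded ((fun g : ℤ × ℤ =>
      koopman μ g (indicatorConstLp 2 hB (measure_ne_top μ B) (1 : ℂ))) '' strip β c) := by
  refine exists_congr fun hB => ⟨fun h => h.totallyBounded.subset subset_closure, fun h => ?_⟩
  exact h.closure.isCompact_of_isClosed isClosed_closure

/-- Superlevel sets, at levels without mass, of real parts or similar real-linear images of
functions with totally bounded orbits lie in the Kronecker algebra. -/
theorem superlevel_mem_kroneckerAlgebra {β c : ℝ} (u : Lp ℂ 2 μ)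
    (hu : TotallyBounded ((fun g => koopman μ g u) '' strip β c)) (L : ℂ →L[ℝ] ℝ)
    (hL : ∀ z, |L z| ≤ ‖z‖) {a : ℝ} (ha : μ {x | L (u x) = a} = 0) :
    {x | a < L (u x)} ∈ kroneckerAlgebra μ β c := by
  have hmeas : Measurable fun x => L (u x) :=
    L.continuous.measurable.comp (Lp.stronglyMeasurable u).measurable
  have hB : MeasurableSet {x | a < L (u x)} := measurableSet_lt measurable_const hmeas
  rw [mem_kroneckerAlgebra_iff]
  refine ⟨hB, totallyBounded_image_of_dist_control hu fun ε hε => ?_⟩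
  have hsmeas : ∀ r, MeasurableSet {x | |L (u x) - a| ≤ r} := fun r =>
    measurableSet_le (hmeas.sub_const a).abs measurable_const
  -- The bands around level `a` decrease to the level set, which has measure zero.
  obtain ⟨η, hη, hηε⟩ : ∃ η > 0, μ {x | |L (u x) - a| ≤ η} < ENNReal.ofReal (ε ^ 2 / 2) := by
    have h1 := tendsto_measure_biInter_gt (μ := μ) (s := fun r => {x | |L (u x) - a| ≤ r}) (a := 0)
      (fun r _ => (hsmeas r).nullMeasurableSet)
      (fun i j _ hij x hx => le_trans (show |L (u x) - a| ≤ i from hx) hij)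
      ⟨1, one_pos, measure_ne_top _ _⟩
    have h2 : (⋂ r > (0 : ℝ), {x | |L (u x) - a| ≤ r}) = {x | L (u x) = a} := by
      ext x
      simp only [Set.mem_iInter]
      constructor
      · intro h
        have : |L (u x) - a| ≤ 0 := le_of_forall_pos_le_add fun r hr => by
          rw [zero_add]; exact h r hr
        exact sub_eq_zero.1 (abs_nonpos_iff.1 this)
      · intro h r hr
        have h' : L (u x) = a := h
        show |L (u x) - a| ≤ r
        rw [h', sub_self, abs_zero]
        exact le_of_lt hr
    rw [h2, ha] at h1
    have h3 := h1.eventually (gt_mem_nhds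
      (ENNReal.ofReal_pos.2 (by positivity) : 0 < ENNReal.ofReal (ε ^ 2 / 2)))
    obtain ⟨η, h4, h5⟩ := (h3.and self_mem_nhdsWithin).exists
    exact ⟨η, h5, h4⟩
  refine ⟨η * (ε / 2), by positivity, fun p _ q _ hpq => ?_⟩
  set T : ℤ × ℤ → X → X := fun g x => g +ᵥ x with hT
  have hTm : ∀ g, MeasurePreserving (T g) μ μ := fun g => measurePreserving_vadd g μ
  set A : Set X := symmDiff (T p ⁻¹' {x | a < L (u x)}) (T q ⁻¹' {x | a < L (u x)}) with hA
  set w : Lp ℂ 2 μ := koopman μ p u - koopman μ q u with hw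
  -- If the two translates of `u` lie on different sides of the level, either the first is within
  -- `η` of it or they differ by at least `η`. The first event is small by the choice of `η`, the
  -- second by Chebyshev.
  have hcover : A ≤ᵐ[μ] (T p ⁻¹' {x | |L (u x) - a| ≤ η} ∪
      {x | ENNReal.ofReal η ≤ (‖w x‖₊ : ENNReal)} : Set X) := by
    filter_upwards [Lp.coeFn_sub (koopman μ p u) (koopman μ q u),
      Lp.coeFn_compMeasurePreserving u (hTm p), Lp.coeFn_compMeasurePreserving u (hTm q)]
      with x h1 h2 h3 hx
    by_contra hcon
    obtain ⟨h4, h5⟩ := not_or.1 hcon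
    have h4' : η < |L (u (T p x)) - a| := not_le.1 h4
    have h5' : ‖w x‖ < η := by
      by_contra h
      refine h5 (?_ : ENNReal.ofReal η ≤ (‖w x‖₊ : ENNReal))
      rw [← enorm_eq_nnnorm, ← ofReal_norm]
      exact ENNReal.ofReal_le_ofReal (not_lt.1 h)
    have h6 : w x = u (T p x) - u (T q x) := by
      rw [hw, h1, Pi.sub_apply]
      exact congrArg₂ _ h2 h3
    have h7 : |L (u (T p x)) - L (u (T q x))| < η := by
      rw [← map_sub, ← h6]; exact (hL _).trans_lt h5'
    have h8 : a < L (u (T p x)) ∧ ¬ a < L (u (T q x)) ∨ a < L (u (T q x)) ∧ ¬ a < L (u (T p x)) :=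
      hx
    rw [abs_lt] at h7
    rcases h8 with ⟨h8, h9⟩ | ⟨h8, h9⟩
    · rw [abs_of_pos (by linarith)] at h4'; linarith
    · rw [abs_of_nonpos (by linarith)] at h4'; linarith
  have hmarkov : μ {x | ENNReal.ofReal η ≤ (‖w x‖₊ : ENNReal)} ≤ ENNReal.ofReal (ε ^ 2 / 4) := by
    have h1 := Lp.meas_ge_le_mul_pow_enorm w (by norm_num) (by norm_num)
      (ENNReal.ofReal_pos.2 hη).ne'
    refine h1.trans ?_
    rw [ENNReal.toReal_ofNat, ENNReal.rpow_ofNat, ENNReal.rpow_ofNat, ← ENNReal.ofReal_inv_of_pos hη,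
      ← ENNReal.ofReal_pow (by positivity), ← ENNReal.ofReal_pow (by positivity),
      ← ENNReal.ofReal_mul (by positivity)]
    refine ENNReal.ofReal_le_ofReal ?_
    have h2 : ‖w‖ ≤ η * (ε / 2) := by rw [hw, ← dist_eq_norm]; exact hpq.le
    calc η⁻¹ ^ 2 * ‖w‖ ^ 2 ≤ η⁻¹ ^ 2 * (η * (ε / 2)) ^ 2 := by gcongr
      _ = ε ^ 2 / 4 := by field_simp; ring
  have hAlt : μ.real A < ε ^ 2 := by
    have h1 : μ A < ENNReal.ofReal (ε ^ 2) := by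
      calc μ A ≤ _ := measure_mono_ae hcover
        _ ≤ μ (T p ⁻¹' {x | |L (u x) - a| ≤ η}) + _ := measure_union_le _ _
        _ = μ {x | |L (u x) - a| ≤ η} + _ := by
          rw [(hTm p).measure_preimage (hsmeas η).nullMeasurableSet]
        _ < ENNReal.ofReal (ε ^ 2 / 2) + ENNReal.ofReal (ε ^ 2 / 4) :=
          ENNReal.add_lt_add_of_lt_of_le (measure_ne_top _ _) hηε hmarkov
        _ = ENNReal.ofReal (ε ^ 2 / 2 + ε ^ 2 / 4) :=
          (ENNReal.ofReal_add (by positivity) (by positivity)).symm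
        _ ≤ _ := ENNReal.ofReal_le_ofReal (by nlinarith)
    exact (ENNReal.lt_ofReal_iff_toReal_lt (measure_ne_top _ _)).1 h1
  have hdist : dist (koopman μ p (indicatorConstLp 2 hB (measure_ne_top μ _) (1 : ℂ)))
      (koopman μ q (indicatorConstLp 2 hB (measure_ne_top μ _) (1 : ℂ)))
      = μ.real A ^ (1 / (2 : ℝ)) := by
    rw [koopman, koopman, Lp.indicatorConstLp_compMeasurePreserving,
      Lp.indicatorConstLp_compMeasurePreserving, dist_indicatorConstLp_eq_norm,
      norm_indicatorConstLp (by norm_num) (by norm_num), norm_one, one_mul, ENNReal.toReal_ofNat]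
  rw [hdist, ← Real.sqrt_eq_rpow]
  exact (Real.sqrt_lt' hε).2 hAlt

/-- In a directionally weakly mixing system only constants have totally bounded orbits along the
strip. -/
theorem exists_eq_const_of_totallyBounded {β c : ℝ} (hwm : IsWeakMixing μ β c) (u : Lp ℂ 2 μ)
    (hu : TotallyBounded ((fun g => koopman μ g u) '' strip β c)) :
    ∃ a, u = Lp.const 2 μ a := by
  have hL : ∀ L : ℂ →L[ℝ] ℝ, (∀ z, |L z| ≤ ‖z‖) →
      ∃ a, (fun x => L (u x)) =ᵐ[μ] Function.const X a := fun L hL =>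
    exists_ae_eq_const_of_superlevel μ
      (L.continuous.measurable.comp (Lp.stronglyMeasurable u).measurable) fun a ha =>
        hwm _ (superlevel_mem_kroneckerAlgebra μ u hu L hL ha)
  obtain ⟨r, hr⟩ := hL Complex.reCLM Complex.abs_re_le_norm
  obtain ⟨s, hs⟩ := hL Complex.imCLM Complex.abs_im_le_norm
  refine ⟨⟨r, s⟩, Lp.ext ?_⟩
  filter_upwards [hr, hs, Lp.coeFn_const 2 μ (⟨r, s⟩ : ℂ)] with x h1 h2 h3
  rw [h3]
  exact Complex.ext h1 h2

end Koopman

/-! ### The two implications -/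

variable {X : Type*} [MeasurableSpace X] [AddAction (ℤ × ℤ) X] [MeasurableConstVAdd (ℤ × ℤ) X]
  (μ : Measure X) [VAddInvariantMeasure (ℤ × ℤ) X μ]

/-- Directional weak mixing implies the mean ergodic theorem along every ordered enumeration of a
set of positive lower density in a strip. -/
theorem IsWeakMixing.tendsto_norm_average [IsProbabilityMeasure μ] {β b c : ℝ} (hb : 0 < b) (hwm : IsWeakMixing μ β c)
    {Q : Set (ℤ × ℤ)} (hQ : Q ⊆ strip β b) (hdens : 0 < lowerRelDensity β b Q)
    {q : ℕ → ℤ × ℤ} (hq : IsOrderedEnumeration Q q) (f : Lp ℂ 2 μ) :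
    Tendsto (fun N : ℕ => ‖(1 / (N : ℂ)) • ∑ i ∈ Finset.range N, koopman μ (q i) f
      - Lp.const 2 μ (∫ x, f x ∂μ)‖) atTop (𝓝 0) := by
  obtain ⟨D, hD, hqD⟩ := exists_abs_fst_le_mul hb hdens hq
  have hmem : ∀ i, q i ∈ strip β b := fun i => hQ (hq.range_eq ▸ Set.mem_range_self i)
  have hlim := tendsto_norm_average_orbit (koopmanIsometry μ) (koopmanIsometry_add μ) hb c
    (f - Lp.const 2 μ (∫ x, f x ∂μ)) (fun u hu => by
      obtain ⟨a, rfl⟩ := exists_eq_const_of_totallyBounded μ hwm u hu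
      rw [inner_const_left, integral_sub_const_integral, inner_zero_right])
    hq.injective hmem hD hqD
  refine hlim.congr' ?_
  filter_upwards [eventually_gt_atTop 0] with N hN
  have hN' : (N : ℂ) ≠ 0 := by exact_mod_cast hN.ne'
  simp only [koopmanIsometry_apply, koopman_sub, koopman_const, Finset.sum_sub_distrib,
    Finset.sum_const, Finset.card_range, smul_sub]
  rw [← Nat.cast_smul_eq_nsmul ℂ N, smul_smul, one_div_mul_cancel hN', one_smul]

/-- For a vector with totally bounded orbit along a strip, the return times within `ε`, in the right
half of a narrow strip, can be enumerated and have positive lower density in the wide strip. -/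
theorem exists_enumeration_of_totallyBounded {β b c : ℝ} (hb : 0 < b) (hc : 0 < c)
    (u : Lp ℂ 2 μ) (hu : TotallyBounded ((fun g => koopman μ g u) '' strip β c)) {ε : ℝ}
    (hε : 0 < ε) :
    ∃ Q : Set (ℤ × ℤ), Q ⊆ strip β b ∧ Q.Infinite ∧ 0 < lowerRelDensity β b Q ∧
      (∀ g ∈ Q, dist (koopman μ g u) u < ε) ∧ ∃ q, IsOrderedEnumeration Q q := by
  -- Width at most 1/2 leaves at most one lattice point per column, so ordering by first coordinate
  -- is an enumeration.
  set b' : ℝ := min b (1 / 2) with hb'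
  have hb'pos : 0 < b' := lt_min hb (by norm_num)
  -- The difference of two points of the strip of width `c'` lies in the strip of width `b'`.
  set c' : ℝ := min c (b' / 2) with hc'
  have hc'pos : 0 < c' := lt_min hc (by positivity)
  set Q : Set (ℤ × ℤ) := {g | 0 ≤ g.1 ∧ g ∈ strip β b' ∧ dist (koopman μ g u) u < ε} with hQ
  have hQb : Q ⊆ strip β b := fun g hg => strip_mono β (min_le_left _ _) hg.2.1
  have hQfin : ∀ k, (Q ∩ slab k).Finite := fun k =>
    (finite_strip_inter_slab β b k).subset (Set.inter_subset_inter_left _ hQb)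
  obtain ⟨F₁, -, hF₁⟩ := exists_finset_height_net β 1 (half_pos hc'pos)
  have hu' : TotallyBounded ((fun g => koopman μ g u) '' strip β c') :=
    hu.subset (Set.image_mono (strip_mono β (min_le_left _ _)))
  obtain ⟨t, hts, htf, htc⟩ := Metric.finite_approx_of_totallyBounded hu' ε hε
  choose p hp hpu using fun y : t => hts y.2
  have := htf.fintype
  -- A point is first moved into the narrow strip by the height net; subtracting a `p` whose
  -- translate of `u` is ε-close then yields a return time.
  obtain ⟨δ, hδ, hgrow⟩ := exists_linear_le_ncard (β := β) hQfin
    ((F₁ ×ˢ Finset.univ.image p).image fun h => h.1 + h.2) (by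
      intro g hg _
      obtain ⟨h, hh, hgh⟩ := hF₁ g hg
      have hgh' : g - h ∈ strip β c' := mem_strip_iff.2 hgh.le
      obtain ⟨y, hy, hyd⟩ := Set.mem_iUnion₂.1 (htc (Set.mem_image_of_mem _ hgh'))
      refine ⟨h + p ⟨y, hy⟩, Finset.mem_image.2 ⟨(h, p ⟨y, hy⟩), Finset.mem_product.2
        ⟨hh, Finset.mem_image_of_mem _ (Finset.mem_univ _)⟩, rfl⟩, fun hnn => ⟨hnn, ?_, ?_⟩⟩
      · rw [← sub_sub]
        refine strip_mono β ?_ (sub_mem_strip hgh' (hp ⟨y, hy⟩))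
        linarith [min_le_right c (b' / 2)]
      · rw [← sub_sub, ← dist_koopman_koopman]
        rw [Metric.mem_ball] at hyd
        have := hpu ⟨y, hy⟩
        dsimp only at this
        rw [this]
        exact hyd)
  have hinf : Q.Infinite := by
    intro hfin
    obtain ⟨k, h1, h2⟩ := (hgrow.and ((tendsto_natCast_atTop_atTop.const_mul_atTop
      hδ).eventually_gt_atTop (Q.ncard : ℝ))).exists
    have h3 : ((Q ∩ slab k).ncard : ℝ) ≤ Q.ncard := by
      exact_mod_cast Set.ncard_le_ncard Set.inter_subset_left hfin
    linarith
  refine ⟨Q, hQb, hinf, ?_, fun g hg => hg.2.2,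
    exists_isOrderedEnumeration hinf (fun g hg => hg.1) ?_⟩
  · have hpos : 0 < δ / (3 * (b + 1)) := by positivity
    refine hpos.trans_le (le_liminf_of_le ?_ ?_)
    · refine IsBoundedUnder.isCoboundedUnder_ge (isBoundedUnder_of ⟨1, fun k => ?_⟩)
      refine div_le_one_of_le₀ ?_ (by positivity)
      exact_mod_cast Set.ncard_le_ncard (Set.inter_subset_inter_left _ hQb)
        (finite_strip_inter_slab β b k)
    · filter_upwards [hgrow, eventually_gt_atTop 0] with k hk hk0
      have hk1 : (1 : ℝ) ≤ k := by exact_mod_cast hk0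
      have h1 := ncard_strip_inter_slab_le β hb.le k
      have h2 : ((Q ∩ slab k).ncard : ℝ) ≤ (strip β b ∩ slab k).ncard := by
        exact_mod_cast Set.ncard_le_ncard (Set.inter_subset_inter_left _ hQb)
          (finite_strip_inter_slab β b k)
      have h3 : 0 < δ * k := by positivity
      have h4 : ((strip β b ∩ slab k).ncard : ℝ) ≤ 3 * (b + 1) * k := by nlinarith
      rw [div_le_div_iff₀ (by positivity) (by linarith)]
      calc δ * ((strip β b ∩ slab k).ncard : ℝ) ≤ δ * (3 * (b + 1) * k) := by gcongr
        _ = δ * k * (3 * (b + 1)) := by ring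
        _ ≤ _ := by gcongr
  · intro g hg h hh hgh
    refine Prod.ext hgh ?_
    have h1 := mem_strip_iff.1 hg.2.1
    have h2 := mem_strip_iff.1 hh.2.1
    rw [height_apply, abs_le] at h1 h2
    have h3 : (g.1 : ℝ) = h.1 := by exact_mod_cast hgh
    rw [h3] at h1
    have h4 : b' ≤ 1 / 2 := min_le_right _ _
    have h5 : |((g.2 - h.2 : ℤ) : ℝ)| < 1 := by
      push_cast
      rw [abs_lt]
      constructor <;> linarith [h1.1, h1.2, h2.1, h2.2]
    have h6 : |g.2 - h.2| < 1 := by exact_mod_cast h5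
    exact sub_eq_zero.1 (Int.abs_lt_one_iff.1 h6)

theorem norm_average_koopman_sub_le (u : Lp ℂ 2 μ) {ε : ℝ} {q : ℕ → ℤ × ℤ}
    (hq : ∀ i, dist (koopman μ (q i) u) u < ε) {N : ℕ} (hN : 0 < N) :
    ‖(1 / (N : ℂ)) • ∑ i ∈ Finset.range N, koopman μ (q i) u - u‖ ≤ ε := by
  have hN' : (N : ℂ) ≠ 0 := by exact_mod_cast hN.ne'
  have hNr : (0 : ℝ) < N := by exact_mod_cast hN
  have h1 : (1 / (N : ℂ)) • ∑ i ∈ Finset.range N, koopman μ (q i) u - u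
      = (1 / (N : ℂ)) • ∑ i ∈ Finset.range N, (koopman μ (q i) u - u) := by
    rw [Finset.sum_sub_distrib, Finset.sum_const, Finset.card_range, smul_sub,
      ← Nat.cast_smul_eq_nsmul ℂ N, smul_smul, one_div_mul_cancel hN', one_smul]
  have h2 : ‖∑ i ∈ Finset.range N, (koopman μ (q i) u - u)‖ ≤ N * ε := by
    refine (norm_sum_le_of_le _ fun i _ => (dist_eq_norm (koopman μ (q i) u) u ▸ (hq i).le)).trans ?_
    rw [Finset.sum_const, Finset.card_range, nsmul_eq_mul]
  rw [h1, norm_smul, norm_div, norm_one, Complex.norm_natCast, one_div_mul_eq_div,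
    div_le_iff₀ hNr]
  linarith

/-- The mean ergodic theorem along all ordered enumerations of sets of positive lower density in
a strip implies directional weak mixing. -/
theorem isWeakMixing_of_tendsto_norm_average [IsProbabilityMeasure μ] {β b c : ℝ}
    (hb : 0 < b) (hc : 0 < c)
    (h : ∀ Q : Set (ℤ × ℤ), Q ⊆ strip β b → Q.Infinite → 0 < lowerRelDensity β b Q →
      ∀ q : ℕ → ℤ × ℤ, IsOrderedEnumeration Q q → ∀ f : Lp ℂ 2 μ,
        Tendsto (fun N : ℕ => ‖(1 / (N : ℂ)) • ∑ i ∈ Finset.range N, koopman μ (q i) f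
          - Lp.const 2 μ (∫ x, f x ∂μ)‖) atTop (𝓝 0)) :
    IsWeakMixing μ β c := by
  intro B hBK
  obtain ⟨hB, htb⟩ := (mem_kroneckerAlgebra_iff μ).1 hBK
  set u : Lp ℂ 2 μ := indicatorConstLp 2 hB (measure_ne_top μ B) (1 : ℂ)
  set v : Lp ℂ 2 μ := Lp.const 2 μ (∫ x, u x ∂μ)
  refine ae_eq_empty_or_univ_of_indicator_eq_const μ hB (a := ∫ x, u x ∂μ) (?_ : u = v)
  -- The averages over ε-return times of `u` are within ε of `u` and converge to `v`, so `u` and `v`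
  -- are within ε of each other for every ε.
  refine dist_le_zero.1 (le_of_forall_pos_le_add fun ε hε => ?_)
  rw [zero_add, dist_eq_norm]
  obtain ⟨Q, hQ, hinf, hdens, hret, q, hq⟩ :=
    exists_enumeration_of_totallyBounded μ hb hc u htb hε
  have hlim := (h Q hQ hinf hdens q hq u).const_add ε
  rw [add_zero] at hlim
  refine ge_of_tendsto hlim ?_
  filter_upwards [eventually_gt_atTop 0] with N hN
  have h1 := norm_average_koopman_sub_le μ u
    (fun i => hret (q i) (hq.range_eq ▸ Set.mem_range_self i)) hN
  rw [norm_sub_rev] at h1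
  exact (norm_sub_le_norm_sub_add_norm_sub _ _ _).trans (add_le_add_left h1 _)

end DirectionalWeakMixing

theorem mainTheorem6 {X : Type*} [MetricSpace X] [CompactSpace X] [MeasurableSpace X] [BorelSpace X]
    [AddAction (ℤ × ℤ) X] [ContinuousConstVAdd (ℤ × ℤ) X]
    (μ : Measure X) [IsProbabilityMeasure μ] [VAddInvariantMeasure (ℤ × ℤ) X μ]
    (β b c : ℝ) (hb : 0 < b) (hc : 0 < c) :
    DirectionalWeakMixing.IsWeakMixing μ β c ↔
      ∀ Q : Set (ℤ × ℤ), Q ⊆ DirectionalWeakMixing.strip β b → Q.Infinite →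
        0 < DirectionalWeakMixing.lowerRelDensity β b Q →
        ∀ q : ℕ → ℤ × ℤ, DirectionalWeakMixing.IsOrderedEnumeration Q q →
        ∀ f : Lp ℂ 2 μ,
          Tendsto (fun N : ℕ =>
            ‖(1 / (N : ℂ)) • ∑ i ∈ Finset.range N, DirectionalWeakMixing.koopman μ (q i) f
              - Lp.const 2 μ (∫ x, f x ∂μ)‖) atTop (𝓝 0) :=
  ⟨fun hwm _ hQ _ hdens _ hq f => hwm.tendsto_norm_average μ hb hQ hdens hq f,
    DirectionalWeakMixing.isWeakMixing_of_tendsto_norm_average μ hb hc⟩
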